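/- Let $\Lambda$ be the ring of symmetric functions over $\mathbb{Z}$ in countably many variables, with complete homogeneous symmetric functions $h_r$ ($h_0=1$, $h_r=0$ for $r<0$). For an integer $t\ge 2$ let $\varphi_t:\Lambda\to\Lambda$ be the ring homomorphism with $\varphi_t h_r=h_{r/t}$ if $t\mid r$ and $\varphi_t h_r=0$ otherwise. For partitions $\lambda,\mu$ put \[ s_{\lambda/\mu}=\det_{1\le i,j\le l(\lambda)}\big(h_{\lambda_i-\mu_j-i+j}\big)\ \text{ if }\mu\subseteq\lambda,\quad s_{\lambda/\mu}=0\ \text{ otherwise}, \] \[ \mathrm{so}_\lambda=\det_{1\le i,j\le l(\lambda)}\big(h_{\lambda_i-i+j}+h_{\lambda_i-i-j+1}\big),\qquad \mathrm{rs}_{\lambda,\mu}=\sum_{\nu}(-1)^{|\nu|}s_{\lambda/\nu}\,s_{\mu/\nu'}, \] where $\nu$ runs over all partitions and $\nu'$ is the conjugate of $\nu$. Let $n\ge 0$ and let $\lambda$ be a partition of length at most $nt$. Let $\beta=\{\lambda_i+nt-i: 1\le i\le nt\}$ and, for $0\le r\le t-1$, let $m_r=m_r(\lambda;nt)$ be the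 number of elements of $\beta$ congruent to $r$ modulo $t$; write these elements as $\xi^{(r)}_kt+r$ with $\xi^{(r)}_1>\dots>\xi^{(r)}_{m_r}\ge 0$. The $t$-quotient $(\lambda^{(0)},\dots,\lambda^{(t-1)})$ of $\lambda$ is given by $\lambda^{(r)}_k=\xi^{(r)}_k-m_r+k$ for $1\le k\le m_r$. If $\tilde\xi_1>\dots>\tilde\xi_{nt}$ are the integers $kt+r$ with $0\le r\le t-1$, $0\le k\le m_r-1$, then the $t$-core of $\lambda$ is given by $t\text{-core}(\lambda)_i=\tilde\xi_i-nt+i$. Let $w_t(\lambda;nt)$ be the permutation of $\beta$ (listed in decreasing order) which sorts its elements so that their residues modulo $t$ increase and the elements within each residue class decrease, and let $\mathrm{rk}$ denote the Frobenius rank (the side length of the Durfee square). Then $\varphi_t\,\mathrm{so}_\lambda=0$ unless $t\text{-core}(\lambda)$ is self-conjugate, in which case \[ \varphi_t\,\mathrm{so}_\lambda=(-1)^{\varepsilon^{\mathrm{so}}_{\lambda;nt}}\,\mathrm{sgn}(w_t(\lambda;nt))\prod_{r=0}^{\lfloor (t-2)/2\rfloor}\mathrm{rs}_{\lambda^{(r)},\lambda^{(t-r-1)}}\times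 \begin{cases}1 & t\text{ even},\\ \mathrm{so}_{\lambda^{((t-1)/2)}} & t\text{ odd},\end{cases} \] where \[ \varepsilon^{\mathrm{so}}_{\lambda;nt}=\sum_{r=\lfloor (t+1)/2\rfloor}^{t-1}\binom{m_r(\lambda;nt)+1}{2}+\begin{cases}0 & t\text{ even},\\ n\,\mathrm{rk}(t\text{-core}(\lambda)) & t\text{ odd}.\end{cases} \] -/

import Mathlib

namespace UniversalCharacters

open MvPolynomial

noncomputable section

/-! ### The ring of symmetric functions -/

/-- Setting the last variable to zero: `f(x_1, …, x_n, x_{n+1}) ↦ f(x_1, …, x_n, 0)`. -/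
def dropLast (n : ℕ) : MvPolynomial (Fin (n + 1)) ℤ →ₐ[ℤ] MvPolynomial (Fin n) ℤ :=
  aeval (Fin.lastCases 0 X)

/-- The ring `Λ` of symmetric functions over `ℤ` in countably many variables `x_1, x_2, …`:
the sequences of symmetric polynomials `f_n ∈ ℤ[x_1, …, x_n]` of bounded degree such that
`f_{n+1}(x_1, …, x_n, 0) = f_n(x_1, …, x_n)`. -/
def SymFun : Subring (∀ n : ℕ, MvPolynomial (Fin n) ℤ) where
  carrier := {f | (∀ n, (f n).IsSymmetric) ∧ (∀ n, dropLast n (f (n + 1)) = f n) ∧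
    ∃ d : ℕ, ∀ n, (f n).totalDegree ≤ d}
  mul_mem' := by
    rintro f g ⟨hf, hf', a, ha⟩ ⟨hg, hg', b, hb⟩
    refine ⟨fun n => (hf n).mul (hg n), fun n => ?_, a + b, fun n => ?_⟩
    · simp [hf' n, hg' n]
    · exact (totalDegree_mul _ _).trans (add_le_add (ha n) (hb n))
  one_mem' := ⟨fun _ => IsSymmetric.one, fun n => by simp, 0, fun n => by simp⟩
  add_mem' := by
    rintro f g ⟨hf, hf', a, ha⟩ ⟨hg, hg', b, hb⟩
    refine ⟨fun n => (hf n).add (hg n), fun n => ?_, max a b, fun n => ?_⟩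
    · simp [hf' n, hg' n]
    · exact (totalDegree_add _ _).trans (max_le_max (ha n) (hb n))
  zero_mem' := ⟨fun _ => IsSymmetric.zero, fun n => by simp, 0, fun n => by simp⟩
  neg_mem' := by
    rintro f ⟨hf, hf', a, ha⟩
    refine ⟨fun n => (hf n).neg, fun n => ?_, a, fun n => ?_⟩
    · simp [hf' n]
    · simpa using ha n

lemma dropLast_rename (n : ℕ) (p : MvPolynomial (Fin n) ℤ) :
    dropLast n (rename Fin.castSucc p) = p := by
  rw [dropLast, aeval_rename]
  have : (Fin.lastCases 0 X : Fin (n + 1) → MvPolynomial (Fin n) ℤ) ∘ Fin.castSucc = X := by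
    ext1 i; simp
  rw [this]; simp

lemma dropLast_X_last (n : ℕ) : dropLast n (X (Fin.last n)) = 0 := by
  simp [dropLast]

lemma hsymm_option {σ : Type*} [Fintype σ] [DecidableEq σ] (r : ℕ) :
    hsymm (Option σ) ℤ (r + 1) =
      X none * hsymm (Option σ) ℤ r + rename some (hsymm σ ℤ (r + 1)) := by
  rw [hsymm, ← (symOptionSuccEquiv (α := σ) (n := r)).symm.sum_comp]
  rw [Fintype.sum_sum_type]
  congr 1
  · rw [hsymm, Finset.mul_sum]
    refine Finset.sum_congr rfl fun s _ => ?_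
    change (Multiset.map X (none ::ₘ (s : Multiset (Option σ)))).prod = _
    rw [Multiset.map_cons, Multiset.prod_cons]
    rfl
  · simp [symOptionSuccEquiv, hsymm, ← Multiset.prod_hom']

lemma hsymm_fin_succ (n r : ℕ) :
    hsymm (Fin (n + 1)) ℤ (r + 1) =
      X (Fin.last n) * hsymm (Fin (n + 1)) ℤ r +
        rename Fin.castSucc (hsymm (Fin n) ℤ (r + 1)) := by
  have h := congrArg (rename (R := ℤ) (finSuccEquivLast (n := n)).symm)
    (hsymm_option (σ := Fin n) r)
  rw [rename_hsymm, map_add, map_mul, rename_hsymm, rename_X, rename_rename] at h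
  rw [h]
  have : (⇑(finSuccEquivLast (n := n)).symm ∘ some) = Fin.castSucc := by
    ext i; simp
  rw [this]; simp

lemma multiset_esymm_cons {R : Type*} [CommSemiring R] (a : R) (s : Multiset R) (r : ℕ) :
    (a ::ₘ s).esymm (r + 1) = s.esymm (r + 1) + a * s.esymm r := by
  simp [Multiset.esymm, Multiset.powersetCard_cons, Multiset.sum_map_mul_left]

lemma esymm_fin_succ (n r : ℕ) :
    esymm (Fin (n + 1)) ℤ (r + 1) =
      X (Fin.last n) * rename Fin.castSucc (esymm (Fin n) ℤ r) +
        rename Fin.castSucc (esymm (Fin n) ℤ (r + 1)) := by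
  have key : ∀ k, rename Fin.castSucc (esymm (Fin n) ℤ k) =
      ((Finset.univ : Finset (Fin n)).val.map
        (fun i => (X (Fin.castSucc i) : MvPolynomial (Fin (n + 1)) ℤ))).esymm k := by
    intro k
    rw [rename_eq_aeval]
    exact aeval_esymm_eq_multiset_esymm (Fin n) ℤ k _
  rw [key, key, esymm_eq_multiset_esymm, Fin.univ_castSuccEmb]
  rw [Finset.cons_val, Multiset.map_cons, multiset_esymm_cons, add_comm (Multiset.esymm _ _)]
  simp [Finset.map_val, Function.comp_def]

lemma dropLast_hsymm (n r : ℕ) :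
    dropLast n (hsymm (Fin (n + 1)) ℤ r) = hsymm (Fin n) ℤ r := by
  cases r with
  | zero => simp
  | succ r => rw [hsymm_fin_succ, map_add, map_mul, dropLast_X_last, dropLast_rename]; simp

lemma dropLast_esymm (n r : ℕ) :
    dropLast n (esymm (Fin (n + 1)) ℤ r) = esymm (Fin n) ℤ r := by
  cases r with
  | zero => simp
  | succ r =>
    rw [esymm_fin_succ, map_add, map_mul, dropLast_X_last, zero_mul, zero_add, dropLast_rename]

lemma hsymm_isHomogeneous (n r : ℕ) : (hsymm (Fin n) ℤ r).IsHomogeneous r := by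
  refine IsHomogeneous.sum _ _ _ fun s _ => ?_
  have : ∀ m : Multiset (Fin n), ((m.map X).prod : MvPolynomial (Fin n) ℤ).IsHomogeneous
      (Multiset.card m) := by
    intro m
    induction m using Multiset.induction_on with
    | empty => simpa using isHomogeneous_one _ _
    | cons a m ih =>
      rw [Multiset.map_cons, Multiset.prod_cons, Multiset.card_cons, add_comm]
      exact (isHomogeneous_X _ _).mul ih
  simpa using this s.1

lemma esymm_isHomogeneous (n r : ℕ) : (esymm (Fin n) ℤ r).IsHomogeneous r := by
  refine IsHomogeneous.sum _ _ _ fun s hs => ?_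
  have := IsHomogeneous.prod s (fun i => (X i : MvPolynomial (Fin n) ℤ)) (fun _ => 1)
    (fun i _ => isHomogeneous_X _ _)
  simpa [(Finset.mem_powersetCard.1 hs).2] using this

/-- The complete homogeneous symmetric function `h_r`, `r ≥ 0`. -/
def hNat (r : ℕ) : SymFun :=
  ⟨fun n => hsymm (Fin n) ℤ r, fun _ => hsymm_isSymmetric _ _ _, fun n => dropLast_hsymm n r,
    r, fun n => (hsymm_isHomogeneous n r).totalDegree_le⟩

/-- The elementary symmetric function `e_r`, `r ≥ 0`. -/
def eNat (r : ℕ) : SymFun :=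
  ⟨fun n => esymm (Fin n) ℤ r, fun _ => esymm_isSymmetric _ _ _, fun n => dropLast_esymm n r,
    r, fun n => (esymm_isHomogeneous n r).totalDegree_le⟩

/-- The complete homogeneous symmetric function `h_r` for `r ∈ ℤ`, with `h_r = 0` for `r < 0`. -/
def hInt (r : ℤ) : SymFun := if 0 ≤ r then hNat r.toNat else 0

/-! ### `Λ` is freely generated by `h_1, h_2, …`

This is what makes the definition of `φ_t` by its values on the `h_r` legitimate. -/

lemma hNat_zero : hNat 0 = 1 := by
  ext1; funext n; simp [hNat]

lemma eNat_zero : eNat 0 = 1 := by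
  ext1; funext n; simp [eNat]

lemma series_fin (n : ℕ) :
    (PowerSeries.mk fun r => hsymm (Fin n) ℤ r) *
      (PowerSeries.mk fun r => (-1) ^ r * esymm (Fin n) ℤ r) = 1 := by
  induction n with
  | zero =>
    have h1 : (PowerSeries.mk fun r => hsymm (Fin 0) ℤ r) = 1 := by
      ext1 r
      cases r with
      | zero => simp
      | succ r => simp [hsymm, PowerSeries.coeff_one]
    have h2 : (PowerSeries.mk fun r => (-1) ^ r * esymm (Fin 0) ℤ r) = 1 := by
      ext1 r
      cases r with
      | zero => simp
      | succ r =>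
        have : Finset.powersetCard (r + 1) (Finset.univ : Finset (Fin 0)) = ∅ :=
          Finset.powersetCard_eq_empty.2 (by simp)
        simp [esymm, PowerSeries.coeff_one, -Finset.univ_eq_empty, this]
    rw [h1, h2, one_mul]
  | succ n ih =>
    set x : MvPolynomial (Fin (n + 1)) ℤ := X (Fin.last n)
    set ρ : MvPolynomial (Fin n) ℤ →+* MvPolynomial (Fin (n + 1)) ℤ :=
      (rename Fin.castSucc : MvPolynomial (Fin n) ℤ →ₐ[ℤ] _).toRingHom with hρ
    have h1 : (PowerSeries.mk fun r => hsymm (Fin (n + 1)) ℤ r) *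
        (1 - PowerSeries.C x * PowerSeries.X) =
        PowerSeries.map ρ (PowerSeries.mk fun r => hsymm (Fin n) ℤ r) := by
      ext1 r
      rw [mul_sub, mul_one, ← mul_assoc, map_sub]
      cases r with
      | zero => simp
      | succ r =>
        rw [PowerSeries.coeff_succ_mul_X, PowerSeries.coeff_mul_C, PowerSeries.coeff_map,
          PowerSeries.coeff_mk, PowerSeries.coeff_mk, PowerSeries.coeff_mk, hsymm_fin_succ]
        simp only [hρ, AlgHom.toRingHom_eq_coe, RingHom.coe_coe]
        ring
    have h2 : (PowerSeries.mk fun r => (-1) ^ r * esymm (Fin (n + 1)) ℤ r) =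
        (1 - PowerSeries.C x * PowerSeries.X) *
        PowerSeries.map ρ (PowerSeries.mk fun r => (-1) ^ r * esymm (Fin n) ℤ r) := by
      ext1 r
      rw [sub_mul, one_mul, mul_assoc, map_sub]
      cases r with
      | zero => simp
      | succ r =>
        rw [PowerSeries.coeff_C_mul, PowerSeries.coeff_succ_X_mul, PowerSeries.coeff_map,
          PowerSeries.coeff_map, PowerSeries.coeff_mk, PowerSeries.coeff_mk,
          PowerSeries.coeff_mk, esymm_fin_succ]
        simp only [hρ, AlgHom.toRingHom_eq_coe, RingHom.coe_coe, map_mul, map_pow, map_neg,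
          map_one]
        ring
    rw [h2, ← mul_assoc, h1, ← map_mul, ih, map_one]

lemma series_symFun :
    (PowerSeries.mk hNat) * (PowerSeries.mk fun r => (-1) ^ r * eNat r) = 1 := by
  ext1 r
  rw [PowerSeries.coeff_mul]
  ext1; funext n
  have := congrArg (PowerSeries.coeff r) (series_fin n)
  rw [PowerSeries.coeff_mul] at this
  have e1 : ∀ s : Finset (ℕ × ℕ), ∀ g : ℕ × ℕ → SymFun,
      ((∑ p ∈ s, g p : SymFun) : ∀ n, MvPolynomial (Fin n) ℤ) n =
        ∑ p ∈ s, (g p : ∀ n, MvPolynomial (Fin n) ℤ) n := by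
    intro s g
    rw [AddSubmonoidClass.coe_finsetSum, Finset.sum_apply]
  rw [e1]
  simp only [PowerSeries.coeff_mk] at this ⊢
  refine Eq.trans (Eq.trans (Finset.sum_congr rfl fun p _ => ?_) this) ?_
  · simp [hNat, eNat]
  · rw [PowerSeries.coeff_one, PowerSeries.coeff_one]; split_ifs <;> simp

/-- The map `ℤ[X_0, X_1, …] → Λ`, `X_i ↦ e_{i+1}`. -/
def eHom : MvPolynomial ℕ ℤ →ₐ[ℤ] SymFun := aeval fun i => eNat (i + 1)

/-- The map `ℤ[X_0, X_1, …] → Λ`, `X_i ↦ h_{i+1}`. -/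
def hHom : MvPolynomial ℕ ℤ →ₐ[ℤ] SymFun := aeval fun i => hNat (i + 1)

/-- The `n`-variable component of a symmetric function. -/
def component (n : ℕ) : SymFun →ₐ[ℤ] MvPolynomial (Fin n) ℤ :=
  ((Pi.evalRingHom (fun n : ℕ => MvPolynomial (Fin n) ℤ) n).comp SymFun.subtype).toIntAlgHom

lemma component_apply (n : ℕ) (f : SymFun) :
    component n f = (f : ∀ n, MvPolynomial (Fin n) ℤ) n := rfl

lemma comp_eHom (n : ℕ) (p : MvPolynomial ℕ ℤ) :
    component n (eHom p) = aeval (fun i => esymm (Fin n) ℤ (i + 1)) p := by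
  have : (component n).comp eHom = aeval (fun i => esymm (Fin n) ℤ (i + 1)) := by
    ext1 i
    simp [eHom, component_apply, eNat]
  exact DFunLike.congr_fun this p

lemma comp_eHom_rename (n : ℕ) (q : MvPolynomial (Fin n) ℤ) :
    component n (eHom (rename Fin.val q)) = (esymmAlgHom (Fin n) ℤ n q : MvPolynomial (Fin n) ℤ) := by
  rw [comp_eHom, aeval_rename, esymmAlgHom_apply]; rfl

lemma eHom_injective : Function.Injective eHom := by
  rw [injective_iff_map_eq_zero]
  intro p hp
  obtain ⟨s, q, rfl⟩ := exists_finset_rename p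
  obtain ⟨N, hN⟩ : ∃ N, ∀ i ∈ s, i < N := ⟨s.sup id + 1, fun i hi =>
    Nat.lt_succ_of_le (Finset.le_sup (f := id) hi)⟩
  have hfac : (Subtype.val : s → ℕ) = Fin.val ∘ (fun i : s => (⟨i, hN i i.2⟩ : Fin N)) := rfl
  rw [hfac, ← rename_rename] at hp ⊢
  set q' := rename (fun i : s => (⟨i, hN i i.2⟩ : Fin N)) q
  have h0 := comp_eHom_rename N q'
  rw [hp, map_zero] at h0
  have : q' = 0 := by
    apply esymmAlgHom_fin_injective (R := ℤ) (le_refl N)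
    rw [map_zero]
    exact Subtype.ext h0.symm
  rw [this, map_zero]

lemma isHomogeneous_comp_eHom (n k : ℕ) (p : MvPolynomial ℕ ℤ)
    (hp : p.IsWeightedHomogeneous (fun i : ℕ => i + 1) k) :
    (component n (eHom p)).IsHomogeneous k := by
  rw [comp_eHom, aeval_def, eval₂_eq]
  refine IsHomogeneous.sum _ _ _ fun m hm => ?_
  have hk : Finsupp.weight (fun i : ℕ => i + 1) m = k := hp (mem_support_iff.1 hm)
  have := (isHomogeneous_C (Fin n) (coeff m p)).mul
    (IsHomogeneous.prod m.support (fun i => esymm (Fin n) ℤ (i + 1) ^ m i)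
      (fun i => (i + 1) * m i) fun i _ => (esymm_isHomogeneous n (i + 1)).pow (m i))
  rw [zero_add] at this
  rw [Finsupp.weight_apply, Finsupp.sum] at hk
  rw [← hk]
  simp only [smul_eq_mul]
  simpa [mul_comm] using this

lemma comp_eHom_component (n k : ℕ) (p : MvPolynomial ℕ ℤ) :
    component n (eHom (weightedHomogeneousComponent (fun i : ℕ => i + 1) k p)) =
      homogeneousComponent k (component n (eHom p)) := by
  induction p using MvPolynomial.induction_on' with
  | add p q hp hq => simp only [map_add, hp, hq]
  | monomial m c =>
    have hw := isWeightedHomogeneous_monomial (fun i : ℕ => i + 1) m c rfl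
    rw [weightedHomogeneousComponent_of_mem hw,
      homogeneousComponent_of_mem (isHomogeneous_comp_eHom n _ _ hw)]
    split_ifs <;> simp

lemma eq_zero_of_dropLast (n : ℕ) (g : MvPolynomial (Fin (n + 1)) ℤ) (hs : g.IsSymmetric)
    (hd : g.totalDegree ≤ n) (h0 : dropLast n g = 0) : g = 0 := by
  have last : ∀ m : Fin (n + 1) →₀ ℕ, m (Fin.last n) = 0 → coeff m g = 0 := by
    intro m hm
    have hcoeff : ∀ p : MvPolynomial (Fin (n + 1)) ℤ,
        coeff (m.comapDomain Fin.castSucc (Fin.castSucc_injective n).injOn) (dropLast n p) =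
          coeff m p := by
      intro p
      induction p using MvPolynomial.induction_on' with
      | add p q hp hq => simp only [map_add, coeff_add, hp, hq]
      | monomial u c =>
        by_cases hu : u (Fin.last n) = 0
        · have hmap : ∀ u : Fin (n + 1) →₀ ℕ, u (Fin.last n) = 0 → u =
              (u.comapDomain Fin.castSucc (Fin.castSucc_injective n).injOn).mapDomain
                Fin.castSucc := by
            intro u hu
            rw [Finsupp.mapDomain_comapDomain _ (Fin.castSucc_injective n)]
            intro i hi
            induction i using Fin.lastCases with
            | last => simp [hu] at hi
            | cast i => exact ⟨i, rfl⟩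
          have hmon : monomial u c = rename Fin.castSucc (monomial
              (u.comapDomain Fin.castSucc (Fin.castSucc_injective n).injOn) c) := by
            rw [rename_monomial, ← hmap u hu]
          conv_lhs => rw [hmon, dropLast_rename]
          rw [coeff_monomial, coeff_monomial]
          by_cases hum : u = m
          · subst hum; simp
          · rw [if_neg hum, if_neg]
            intro hh
            apply hum
            rw [hmap u hu, hmap m hm, hh]
        · have hz : dropLast n (monomial u c) = 0 := by
            rw [dropLast, aeval_monomial, Finsupp.prod,
              Finset.prod_eq_zero (i := Fin.last n) (by simpa using hu) (by simp [hu]), mul_zero]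
          rw [hz, coeff_zero, coeff_monomial, if_neg]
          rintro rfl
          exact hu hm
    rw [← hcoeff, h0, coeff_zero]
  ext m
  rw [coeff_zero]
  by_contra hm
  have hdeg : m.degree ≤ n := (le_totalDegree (mem_support_iff.2 hm)).trans hd
  obtain ⟨i, hi⟩ : ∃ i, m i = 0 := by
    by_contra! hne
    have : n + 1 ≤ m.degree := by
      rw [Finsupp.degree_eq_sum]
      calc n + 1 = ∑ _i : Fin (n + 1), 1 := by simp
        _ ≤ _ := Finset.sum_le_sum fun i _ => Nat.one_le_iff_ne_zero.2 (hne i)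
    omega
  apply hm
  rw [← hs (Equiv.swap i (Fin.last n))]
  have hmm : m = (m.mapDomain (Equiv.swap i (Fin.last n))).mapDomain
      (Equiv.swap i (Fin.last n)) := by
    rw [← Finsupp.mapDomain_comp]
    convert (Finsupp.mapDomain_id).symm
    ext1 j; simp
  rw [hmm, coeff_rename_mapDomain _ (Equiv.injective _)]
  apply last
  have := Finsupp.mapDomain_apply (Equiv.swap i (Fin.last n)).injective m i
  rw [Equiv.swap_apply_left] at this
  rw [this, hi]

lemma eHom_surjective : Function.Surjective eHom := by
  intro f
  obtain ⟨hs, hc, d, hd⟩ := f.2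
  obtain ⟨q, hq⟩ := esymmAlgHom_fin_surjective ℤ (le_refl d) ⟨_, hs d⟩
  set p := ∑ k ∈ Finset.range (d + 1),
    weightedHomogeneousComponent (fun i : ℕ => i + 1) k (rename Fin.val q)
  have hp : ∀ n, component n (eHom p) = ∑ k ∈ Finset.range (d + 1),
      homogeneousComponent k (component n (eHom (rename Fin.val q))) := by
    intro n
    simp only [p, map_sum, comp_eHom_component]
  have hdeg : ∀ n, (component n (eHom p)).totalDegree ≤ d := by
    intro n
    rw [hp]
    refine totalDegree_finsetSum_le fun k hk => ?_
    exact (homogeneousComponent_isHomogeneous _ _).totalDegree_le.trans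
      (Nat.lt_succ_iff.1 (Finset.mem_range.1 hk))
  have hd0 : component d (eHom p) = component d f := by
    rw [hp, comp_eHom_rename, hq]
    change ∑ k ∈ Finset.range (d + 1), homogeneousComponent k (component d f) = component d f
    conv_rhs => rw [← sum_homogeneousComponent (component d f)]
    symm
    apply Finset.sum_subset
    · intro k hk
      have h1 := hd d
      rw [← component_apply] at h1
      simp only [Finset.mem_range] at hk ⊢
      omega
    · intro k _ hk
      apply homogeneousComponent_eq_zero
      simp only [Finset.mem_range] at hk
      omega
  refine ⟨p, ?_⟩
  have hcomp : ∀ g : SymFun, ∀ n, dropLast n (component (n + 1) g) = component n g :=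
    fun g n => g.2.2.1 n
  have hup : ∀ k, component (d + k) (eHom p) = component (d + k) f := by
    intro k
    induction k with
    | zero => exact hd0
    | succ k ih =>
      rw [← sub_eq_zero]
      apply eq_zero_of_dropLast (d + k)
      · exact ((eHom p).2.1 _).sub (hs _)
      · refine (totalDegree_sub _ _).trans (max_le ?_ ?_)
        · exact (hdeg _).trans (by omega)
        · exact (hd _).trans (by omega)
      · rw [map_sub]
        exact sub_eq_zero.2 ((hcomp _ _).trans (ih.trans (hcomp _ _).symm))
  have hdown : ∀ k n, component (n + k) (eHom p) = component (n + k) f → component n (eHom p) = component n f := by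
    intro k
    induction k with
    | zero => intro n hn; exact hn
    | succ k ih =>
      intro n hn
      apply ih
      exact (hcomp _ _).symm.trans ((congrArg (dropLast (n + k)) hn).trans (hcomp _ _))
  ext1; funext n
  exact hdown d n (by rw [add_comm]; exact hup n)

/-- The generating series `∑ (-1)^r x_r z^r` with `x_0 = 1`, `x_{i+1} = X_i`. -/
def signedSeries : PowerSeries (MvPolynomial ℕ ℤ) :=
  PowerSeries.mk fun r => (-1) ^ r * Nat.casesOn r 1 X

lemma signedSeries_mul_inv :
    signedSeries * PowerSeries.invOfUnit signedSeries 1 = 1 :=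
  PowerSeries.mul_invOfUnit _ _ (by
    rw [← PowerSeries.coeff_zero_eq_constantCoeff_apply]; simp [signedSeries])

/-- The change of generators `e ↔ h`, on polynomial expressions. -/
def omega : MvPolynomial ℕ ℤ →ₐ[ℤ] MvPolynomial ℕ ℤ :=
  aeval fun i => PowerSeries.coeff (i + 1) (PowerSeries.invOfUnit signedSeries 1)

lemma map_omega_signedSeries :
    PowerSeries.map (omega : MvPolynomial ℕ ℤ →+* MvPolynomial ℕ ℤ) signedSeries =
      PowerSeries.evalNegHom (PowerSeries.invOfUnit signedSeries 1) := by
  ext1 r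
  rw [PowerSeries.evalNegHom, PowerSeries.coeff_rescale, PowerSeries.coeff_map]
  cases r with
  | zero => simp [signedSeries]
  | succ r => simp [signedSeries, omega]

lemma omega_omega (p : MvPolynomial ℕ ℤ) : omega (omega p) = p := by
  have h1 := congrArg (PowerSeries.map (omega : MvPolynomial ℕ ℤ →+* MvPolynomial ℕ ℤ))
    signedSeries_mul_inv
  rw [map_mul, map_one, map_omega_signedSeries] at h1
  have h2 := congrArg (PowerSeries.evalNegHom (A := MvPolynomial ℕ ℤ)) signedSeries_mul_inv
  rw [map_mul, map_one] at h2
  have h3 : PowerSeries.map (omega : MvPolynomial ℕ ℤ →+* MvPolynomial ℕ ℤ)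
      (PowerSeries.invOfUnit signedSeries 1) = PowerSeries.evalNegHom signedSeries := by
    rw [mul_comm] at h1
    exact left_inv_eq_right_inv h1 (by rw [mul_comm]; exact h2)
  have : omega.comp omega = AlgHom.id ℤ _ := by
    ext1 i
    have h4 := congrArg (PowerSeries.coeff (i + 1)) h3
    rw [PowerSeries.evalNegHom, PowerSeries.coeff_rescale, PowerSeries.coeff_map] at h4
    simp only [signedSeries, PowerSeries.coeff_mk, ← mul_assoc, ← pow_add] at h4
    rw [Even.neg_one_pow ⟨_, rfl⟩, one_mul] at h4
    simpa [omega, signedSeries] using h4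
  exact DFunLike.congr_fun this p

lemma hHom_eq : hHom = eHom.comp omega := by
  have hA : PowerSeries.map (eHom : MvPolynomial ℕ ℤ →+* SymFun) signedSeries =
      PowerSeries.mk fun r => (-1) ^ r * eNat r := by
    ext1 r
    rw [PowerSeries.coeff_map]
    cases r with
    | zero => simp [signedSeries, eNat_zero]
    | succ r => simp [signedSeries, eHom]
  have h1 := congrArg (PowerSeries.map (eHom : MvPolynomial ℕ ℤ →+* SymFun)) signedSeries_mul_inv
  rw [map_mul, map_one, hA] at h1
  have h2 := left_inv_eq_right_inv series_symFun h1
  ext1 i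
  have h3 := congrArg (PowerSeries.coeff (i + 1)) h2
  rw [PowerSeries.coeff_map, PowerSeries.coeff_mk] at h3
  simpa [hHom, omega] using h3

lemma hHom_bijective : Function.Bijective hHom := by
  rw [hHom_eq, AlgHom.coe_comp]
  exact Function.Bijective.comp ⟨eHom_injective, eHom_surjective⟩
    (Function.Involutive.bijective omega_omega)

/-- `Λ = ℤ[h_1, h_2, …]`, a polynomial ring in the `h_r`, `r ≥ 1`. -/
def hEquiv : MvPolynomial ℕ ℤ ≃ₐ[ℤ] SymFun := AlgEquiv.ofBijective hHom hHom_bijective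

/-! ### The operator `φ_t` -/

/-- The ring homomorphism `φ_t : Λ → Λ` with `φ_t h_r = h_{r/t}` if `t ∣ r` and `φ_t h_r = 0`
otherwise. -/
def phi (t : ℕ) : SymFun →+* SymFun :=
  ((aeval fun i : ℕ => if t ∣ i + 1 then hNat ((i + 1) / t) else 0 :
    MvPolynomial ℕ ℤ →ₐ[ℤ] SymFun).comp hEquiv.symm.toAlgHom :
      SymFun →ₐ[ℤ] SymFun)

lemma phi_hNat (t r : ℕ) : phi t (hNat r) = if t ∣ r then hNat (r / t) else 0 := by
  cases r with
  | zero => simp [hNat_zero]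
  | succ r =>
    have : hEquiv.symm (hNat (r + 1)) = X r := by
      rw [AlgEquiv.symm_apply_eq]
      simp [hEquiv, hHom]
    simp [phi, this]

lemma phi_hInt {t : ℕ} (ht : 0 < t) (r : ℤ) :
    phi t (hInt r) = if (t : ℤ) ∣ r then hInt (r / t) else 0 := by
  by_cases hr : 0 ≤ r
  · obtain ⟨k, rfl⟩ := Int.eq_ofNat_of_zero_le hr
    rw [hInt, if_pos hr, Int.toNat_natCast, phi_hNat]
    simp only [Int.natCast_dvd_natCast]
    split_ifs
    · rw [hInt, if_pos (by positivity), ← Int.natCast_div, Int.toNat_natCast]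
    · rfl
  · have h1 : ¬ 0 ≤ r / (t : ℤ) := by
      have := Int.ediv_neg_of_neg_of_pos (not_le.1 hr) (Int.natCast_pos.2 ht)
      omega
    simp [hInt, hr, h1]

/-! ### Partitions

A partition `λ` is a Young diagram; its part `λ_{i+1}` is `lam.rowLen i`, its length `l(λ)` is
`lam.colLen 0` and its conjugate `λ'` is `lam.transpose`. -/

/-- The Frobenius rank: the number of diagonal squares, i.e. the side length of the largest
square contained in the diagram. -/
def rk (lam : YoungDiagram) : ℕ := (lam.cells.filter fun c => c.1 = c.2).card

/-- The partition with beta set `S = {ξ_1 > ⋯ > ξ_m}`: its parts are `ξ_k - m + k`, `1 ≤ k ≤ m`.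
(With `k` counted from `0`, `ξ` is the entry of `S` that has `m - 1 - k` smaller ones.) -/
def ofBeta (S : Finset ℕ) : YoungDiagram :=
  YoungDiagram.ofRowLens
    (List.ofFn fun k : Fin S.card => S.orderEmbOfFin rfl k.rev - (k.rev : ℕ)) (by
      rw [List.sortedGE_ofFn_iff]
      have key : Monotone fun k : Fin S.card => S.orderEmbOfFin rfl k - (k : ℕ) := by
        intro a b hab
        have : ∀ (d : ℕ) (a b : Fin S.card), (b : ℕ) = a + d →
            S.orderEmbOfFin rfl a + d ≤ S.orderEmbOfFin rfl b := by
          intro d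
          induction d with
          | zero => intro a b hb; rw [Fin.ext (a := a) (b := b) (by omega)]; simp
          | succ d ih =>
            intro a b hb
            have h1 := ih a ⟨a + d, by omega⟩ rfl
            have h2 : S.orderEmbOfFin rfl ⟨a + d, by omega⟩ < S.orderEmbOfFin rfl b :=
              (S.orderEmbOfFin rfl).strictMono (Fin.lt_def.2 (by simp; omega))
            omega
        have h1 := this (b - a) a b (by have := Fin.le_def.1 hab; omega)
        have h2 := Fin.le_def.1 hab
        dsimp only
        omega
      intro a b hab
      exact key (Fin.rev_le_rev.2 hab))

/-- The `i`-th largest element `λ_i + n - i` of the beta set (`i` counted from `0` here). -/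
def bead (lam : YoungDiagram) (n : ℕ) (i : Fin n) : ℕ := lam.rowLen i + (n - 1 - i)

/-- The beta set `β(λ; n) = {λ_1 + n - 1, …, λ_{n-1} + 1, λ_n}`, for `n ≥ l(λ)`. -/
def beta (lam : YoungDiagram) (n : ℕ) : Finset ℕ := Finset.univ.image (bead lam n)

/-- `m_r(λ; n)`, the number of elements of `β(λ; n)` congruent to `r` modulo `t`. -/
def mr (t : ℕ) (lam : YoungDiagram) (n r : ℕ) : ℕ :=
  ((beta lam n).filter fun x => x % t = r).card

/-- The constituent `λ^(r)` of the `t`-quotient, computed with `n` beads: the partition whose beta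
set consists of the `ξ` with `ξ t + r ∈ β(λ; n)`. -/
def quot (t : ℕ) (lam : YoungDiagram) (n r : ℕ) : YoungDiagram :=
  ofBeta (((beta lam n).filter fun x => x % t = r).image fun x => x / t)

/-- The `t`-core of `λ`, computed with `n` beads: the partition whose beta set consists of the
numbers `k t + r` with `0 ≤ r < t` and `0 ≤ k < m_r(λ; n)`. -/
def core (t : ℕ) (lam : YoungDiagram) (n : ℕ) : YoungDiagram :=
  ofBeta ((Finset.range t).biUnion fun r =>
    (Finset.range (mr t lam n r)).image fun k => k * t + r)

/-- The permutation `w_t(λ; n)` which sorts the elements of the beta set so that their residues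
modulo `t` increase and the elements within each residue class decrease. The beads are labelled
in decreasing order, so this is the stable sort of the labels by residue. -/
def wPerm (t : ℕ) (lam : YoungDiagram) (n : ℕ) : Equiv.Perm (Fin n) :=
  Tuple.sort fun i => bead lam n i % t

/-! ### Universal characters -/

/-- The skew Schur function
`s_{λ/μ} = det (h_{λ_i - μ_j - i + j})_{1 ≤ i, j ≤ l(λ)}`, and `0` if `μ ⊄ λ`. -/
def skewSchur (lam mu : YoungDiagram) : SymFun :=
  open scoped Classical in
  if mu ≤ lam then
    Matrix.det (Matrix.of fun i j : Fin (lam.colLen 0) =>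
      hInt ((lam.rowLen i : ℤ) - mu.rowLen j - i + j))
  else 0

/-- The universal character
`so_λ = det (h_{λ_i - i + j} + h_{λ_i - i - j + 1})_{1 ≤ i, j ≤ l(λ)}`.
The indices `i`, `j` run from `0` in the code. -/
def so (lam : YoungDiagram) : SymFun :=
  Matrix.det (Matrix.of fun i j : Fin (lam.colLen 0) =>
    hInt ((lam.rowLen i : ℤ) - (i + 1) + (j + 1)) +
      hInt ((lam.rowLen i : ℤ) - (i + 1) - (j + 1) + 1))

/-- The universal rational character
`rs_{λ,μ} = ∑_ν (-1)^{|ν|} s_{λ/ν} s_{μ/ν'}`, the sum over all partitions `ν`, of which only those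
with `ν ⊆ λ` and `ν' ⊆ μ` contribute. -/
def rs (lam mu : YoungDiagram) : SymFun :=
  ∑ᶠ nu : YoungDiagram, (-1) ^ nu.card * skewSchur lam nu * skewSchur mu nu.transpose

lemma rs_finite_support (lam mu : YoungDiagram) :
    (Function.support fun nu : YoungDiagram =>
      (-1) ^ nu.card * skewSchur lam nu * skewSchur mu nu.transpose).Finite := by
  have hfin : {nu : YoungDiagram | nu ≤ lam}.Finite := by
    refine Set.Finite.of_finite_image (f := YoungDiagram.cells)
      ((lam.cells.powerset.finite_toSet).subset ?_) ?_
    · rintro _ ⟨nu, hnu, rfl⟩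
      exact Finset.mem_coe.2 (Finset.mem_powerset.2 (YoungDiagram.cells_subset_iff.2 hnu))
    · intro a _ b _ hab
      exact YoungDiagram.ext hab
  refine hfin.subset fun nu hnu => ?_
  by_contra hle
  apply hnu
  have : ¬ nu ≤ lam := hle
  simp [skewSchur, this]

/-- The exponent `ε^so_{λ;nt} = ∑_{r=⌊(t+1)/2⌋}^{t-1} binom(m_r(λ;nt) + 1, 2)`, plus
`n rk(t-core(λ))` if `t` is odd. -/
def epsSo (t n : ℕ) (lam : YoungDiagram) : ℕ :=
  (∑ r ∈ Finset.Icc ((t + 1) / 2) (t - 1), (mr t lam (n * t) r + 1).choose 2) +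
    (if Even t then 0 else n * rk (core t lam (n * t)))

end

end UniversalCharacters

open UniversalCharacters

/-! Pad the determinant of `so lam` to size `n * t` (`so_eq_det`). Its rows are then labelled by the
beads `b` and its columns by `0 ≤ j < n * t`, with entry `h_{b+1+j-nt} + h_{b-nt-j}`. After `phi t`
the first summand survives only if `b ≡ -1 - j` modulo `t` and the second only if `b ≡ j`, so a bead
on runner `r` meets only columns of residue `r` or `t - 1 - r`.

Every residue class contains `n` columns. A nonzero term of the determinant therefore forces `m_r +
m_{t-1-r} = 2n` for all `r` (`mr_add_mr_of_det_ne_zero`). Conjugation reflects and complements the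
bead set in `[0, 2nt)`, so this balance condition is exactly self-conjugacy of the core
(`transpose_core_eq_iff`).

In the balanced case the entry is invariant under `j ↦ -1 - j`. The columns can thus be shared out
so that runner `r` receives `m_r` of them with a uniform formula for the entries
(`phiEntry_colNat`). The matrix splits into one block for each pair of opposite runners and, for odd
`t`, one for the middle runner. The middle block is the determinant of an odd orthogonal character.
A paired block is Koike's determinant for `rs`, which is proved in `rs_eq_det` by Laplace expansion:
sets of columns correspond to diagrams in a box, and complementary sets to their conjugates.

The sign compares the order of the rows with that of the matched columns. It is factored through the
order by runners: rows against runners gives `sgn w_t` (`Balanced.sign_wPerm`), and runners against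
columns gives `ε^so` (`Balanced.orderSign_lex_col`, `neg_one_pow_epsSo`). The latter uses an
intermediate order by pairs of runners, whose sign relative to the columns does not depend on the
bead counts. -/

namespace UniversalCharacters

/-! ### Relative signs of orderings -/

section Sign

variable {ι κ α β γ δ : Type*} [Fintype ι] [Fintype κ] [LinearOrder α] [LinearOrder β]
  [LinearOrder γ] [LinearOrder δ]

/-- The parity of the number of pairs on which the orderings of `ι` by the keys `f` and `g`
disagree; each pair is listed once, in the order of the key `k`. -/
def orderSign (k : ι → δ) (f : ι → α) (g : ι → β) : ℤ :=
  ∏ x, ∏ y, if k x < k y then (if f x < f y ↔ g x < g y then 1 else -1) else 1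

/-- A cocycle identity: two orderings that each agree or each disagree with a third one on a pair
agree with each other there. It lets a sign be computed through any convenient intermediate
ordering. -/
lemma orderSign_mul (k : ι → δ) (f : ι → α) (g : ι → β) (h : ι → γ) :
    orderSign k f g * orderSign k g h = orderSign k f h := by
  simp only [orderSign, ← Finset.prod_mul_distrib]
  refine Finset.prod_congr rfl fun x _ => Finset.prod_congr rfl fun y _ => ?_
  by_cases hk : k x < k y <;> by_cases h1 : f x < f y <;> by_cases h2 : g x < g y <;>
    by_cases h3 : h x < h y <;> simp [hk, h1, h2, h3]

lemma orderSign_comm (k : ι → δ) (f : ι → α) (g : ι → β) :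
    orderSign k f g = orderSign k g f := by
  simp only [orderSign, iff_comm]

lemma orderSign_mul_self (k : ι → δ) (f : ι → α) (g : ι → β) :
    orderSign k f g * orderSign k f g = 1 := by
  nth_rw 2 [orderSign_comm]
  rw [orderSign_mul]
  simp [orderSign]

/-- Each discordant pair is met exactly once as an ordered pair `(x, y)` increasing for `f` and
decreasing for `g`. The right side no longer mentions `k`, which is how the choice of key becomes
irrelevant in `orderSign_key`. -/
lemma orderSign_eq_prod {k : ι → δ} {f : ι → α} {g : ι → β} (hk : Function.Injective k)
    (hf : Function.Injective f) (hg : Function.Injective g) :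
    orderSign k f g = ∏ x, ∏ y, if f x < f y ∧ g y < g x then (-1 : ℤ) else 1 := by
  have h1 : (∏ x, ∏ y, if f x < f y ∧ g y < g x then (-1 : ℤ) else 1) =
      (∏ x, ∏ y, if k x < k y then (if f x < f y ∧ g y < g x then (-1 : ℤ) else 1) else 1) *
      (∏ x, ∏ y, if k y < k x then (if f x < f y ∧ g y < g x then (-1 : ℤ) else 1) else 1) := by
    simp only [← Finset.prod_mul_distrib]
    refine Finset.prod_congr rfl fun x _ => Finset.prod_congr rfl fun y _ => ?_
    rcases lt_trichotomy (k x) (k y) with h | h | h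
    · simp [h, h.not_gt]
    · have := hk h; subst this; simp
    · simp [h, h.not_gt]
  rw [h1, Finset.prod_comm (f := fun x y => if k y < k x then _ else _)]
  simp only [orderSign, ← Finset.prod_mul_distrib]
  refine Finset.prod_congr rfl fun x _ => Finset.prod_congr rfl fun y _ => ?_
  by_cases hxy : x = y
  · subst hxy; simp
  · rcases lt_or_gt_of_ne (hf.ne hxy) with h | h <;> rcases lt_or_gt_of_ne (hg.ne hxy) with h' | h' <;>
      simp [h, h', h.not_gt, h'.not_gt]

lemma orderSign_key {k : ι → δ} {k' : ι → γ} {f : ι → α} {g : ι → β}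
    (hk : Function.Injective k) (hk' : Function.Injective k')
    (hf : Function.Injective f) (hg : Function.Injective g) :
    orderSign k f g = orderSign k' f g := by
  rw [orderSign_eq_prod hk hf hg, orderSign_eq_prod hk' hf hg]

lemma orderSign_comp (e : κ ≃ ι) (k : ι → δ) (f : ι → α) (g : ι → β) :
    orderSign (k ∘ e) (f ∘ e) (g ∘ e) = orderSign k f g := by
  simp only [orderSign, Function.comp]
  rw [← e.prod_comp]
  refine Finset.prod_congr rfl fun x _ => ?_
  rw [← e.prod_comp]

lemma orderSign_congr {α' β' : Type*} [LinearOrder α'] [LinearOrder β'] (k : ι → δ)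
    {f : ι → α} {g : ι → β} {f' : ι → α'} {g' : ι → β'}
    (hf : ∀ x y, f x < f y ↔ f' x < f' y) (hg : ∀ x y, g x < g y ↔ g' x < g' y) :
    orderSign k f g = orderSign k f' g' := by
  simp only [orderSign, hf, hg]

lemma sign_eq_orderSign {N : ℕ} (σ : Equiv.Perm (Fin N)) :
    ((Equiv.Perm.sign σ : ℤˣ) : ℤ) = orderSign id id σ := by
  rw [Equiv.Perm.sign_eq_prod_prod_Ioi, orderSign]
  push_cast
  refine Finset.prod_congr rfl fun x _ => ?_
  rw [← Finset.prod_filter]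
  refine Finset.prod_congr (by ext y; simp) fun y hy => ?_
  have hy : x < y := by simpa using hy
  by_cases h : σ x < σ y <;> simp [hy, h]

lemma sign_symm_trans {N : ℕ} (f g : ι ≃ Fin N) {k : ι → δ} (hk : Function.Injective k) :
    ((Equiv.Perm.sign (f.symm.trans g) : ℤˣ) : ℤ) = orderSign k f g := by
  rw [sign_eq_orderSign, ← orderSign_comp f]
  refine (orderSign_congr _ (by simp) (by simp)).trans
    (orderSign_key (by simpa using f.injective) hk f.injective g.injective)

end Sign

/-! ### Determinants -/

section Det

variable {R : Type*} [CommRing R]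

/-- Both vanishing arguments, for non-contained skew shapes and for cores that are not
self-conjugate, start from such a transversal and end in a count. -/
lemma exists_perm_of_det_ne_zero {ι : Type*} [Fintype ι] [DecidableEq ι] {M : Matrix ι ι R}
    (h : M.det ≠ 0) : ∃ σ : Equiv.Perm ι, ∀ j, M (σ j) j ≠ 0 := by
  by_contra! hσ
  apply h
  rw [Matrix.det_apply']
  refine Finset.sum_eq_zero fun σ _ => ?_
  obtain ⟨j, hj⟩ := hσ σ
  exact mul_eq_zero_of_right _ (Finset.prod_eq_zero (Finset.mem_univ j) hj)

lemma det_submatrix_equiv {ι δ : Type*} [Fintype ι] [DecidableEq ι] [LinearOrder δ] {N : ℕ}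
    (M : Matrix (Fin N) (Fin N) R) (f g : ι ≃ Fin N) {k : ι → δ} (hk : Function.Injective k) :
    (M.submatrix f g).det = (orderSign k f g : ℤ) * M.det := by
  rw [← sign_symm_trans f g hk, ← Matrix.det_permute', ← Matrix.det_submatrix_equiv_self f]
  congr 1
  ext i j
  simp

/-- A square matrix whose last diagonal block is upper unitriangular and has zeros to its left. -/
lemma det_castLE {m l : ℕ} (hl : l ≤ m) (f : ℕ → ℕ → R)
    (h0 : ∀ i j, l ≤ i → j < i → f i j = 0) (h1 : ∀ i, l ≤ i → f i i = 1) :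
    (Matrix.of fun i j : Fin m => f i j).det = (Matrix.of fun i j : Fin l => f i j).det := by
  obtain ⟨d, rfl⟩ := Nat.exists_eq_add_of_le hl
  clear hl
  rw [← Matrix.det_submatrix_equiv_self finSumFinEquiv]
  have : (Matrix.of fun i j : Fin (l + d) => f i j).submatrix finSumFinEquiv finSumFinEquiv =
      Matrix.fromBlocks (Matrix.of fun i j : Fin l => f i j)
        (Matrix.of fun (i : Fin l) (j : Fin d) => f i (l + j)) 0
        (Matrix.of fun (i j : Fin d) => f (l + i) (l + j)) := by
    ext (i | i) (j | j)
    · simp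
    · simp
    · simp only [Matrix.submatrix_apply, finSumFinEquiv_apply_right, finSumFinEquiv_apply_left,
        Matrix.of_apply, Matrix.fromBlocks_apply₂₁, Matrix.zero_apply]
      exact h0 _ _ (by simp) (by simp; omega)
    · simp
  have hD : (Matrix.of fun (i j : Fin d) => f (l + i) (l + j)).det = 1 := by
    rw [Matrix.det_of_isUpperTriangular]
    · simp [h1]
    · intro i j hij
      exact h0 _ _ (by simp) (by simpa using hij)
  rw [this, Matrix.det_fromBlocks_zero₂₁, hD, mul_one]

end Det

/-! ### Beta sets -/

lemma rowLen_eq_zero {lam : YoungDiagram} {i : ℕ} (h : lam.colLen 0 ≤ i) : lam.rowLen i = 0 := by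
  by_contra h0
  have : (i, 0) ∈ lam := YoungDiagram.mem_iff_lt_rowLen.2 (Nat.pos_of_ne_zero h0)
  exact absurd (YoungDiagram.mem_iff_lt_colLen.1 this) (by omega)

lemma lt_rowLen_iff_lt_colLen (lam : YoungDiagram) (i j : ℕ) :
    j < lam.rowLen i ↔ i < lam.colLen j :=
  YoungDiagram.mem_iff_lt_rowLen.symm.trans YoungDiagram.mem_iff_lt_colLen

lemma bead_strictAnti (lam : YoungDiagram) (m : ℕ) : StrictAnti (bead lam m) := by
  intro i j hij
  have := lam.rowLen_anti i j (by exact_mod_cast hij.le)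
  have h := Fin.lt_def.1 hij
  unfold bead
  omega

lemma bead_lt_iff (lam : YoungDiagram) (m : ℕ) {i j : Fin m} :
    bead lam m i < bead lam m j ↔ j < i :=
  (bead_strictAnti lam m).lt_iff_gt

lemma card_beta (lam : YoungDiagram) (m : ℕ) : (beta lam m).card = m := by
  rw [beta, Finset.card_image_of_injective _ (bead_strictAnti lam m).injective]
  simp

lemma mem_beta {lam : YoungDiagram} {m x : ℕ} : x ∈ beta lam m ↔ ∃ i, bead lam m i = x := by
  simp [beta]

/-- Guarantees that the truncated subtraction in `ofBeta` never truncates. -/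
lemma le_orderEmbOfFin {S : Finset ℕ} (a : Fin S.card) : (a : ℕ) ≤ S.orderEmbOfFin rfl a := by
  obtain ⟨a, ha⟩ := a
  induction a with
  | zero => simp
  | succ a ih =>
    have h1 := ih (by omega)
    have h2 : S.orderEmbOfFin rfl ⟨a, by omega⟩ < S.orderEmbOfFin rfl ⟨a + 1, ha⟩ :=
      (S.orderEmbOfFin rfl).strictMono (Fin.lt_def.2 (by simp))
    simp only at h1 ⊢
    omega

lemma bead_ofBeta (S : Finset ℕ) (k : Fin S.card) :
    bead (ofBeta S) S.card k = S.orderEmbOfFin rfl k.rev := by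
  have h : (ofBeta S).rowLen k = S.orderEmbOfFin rfl k.rev - (k.rev : ℕ) := by
    refine (YoungDiagram.rowLen_ofRowLens ⟨k, by simp⟩).trans ?_
    simp
  have h2 := le_orderEmbOfFin k.rev
  rw [bead, h]
  simp only [Fin.val_rev] at h2 ⊢
  omega

lemma beta_ofBeta (S : Finset ℕ) : beta (ofBeta S) S.card = S := by
  ext x
  rw [mem_beta]
  simp only [bead_ofBeta]
  rw [← Fin.rev_surjective.exists (p := fun k => S.orderEmbOfFin rfl k = x)]
  have := Finset.range_orderEmbOfFin S rfl
  rw [← Finset.mem_coe, ← this]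
  rfl

lemma colLen_ofBeta (S : Finset ℕ) : (ofBeta S).colLen 0 ≤ S.card := by
  by_contra! h
  have h1 := YoungDiagram.mem_iff_lt_colLen.2 h
  rw [ofBeta, YoungDiagram.mem_ofRowLens] at h1
  simp at h1

lemma eq_of_rowLen {lam mu : YoungDiagram} (h : ∀ i, lam.rowLen i = mu.rowLen i) : lam = mu := by
  ext ⟨i, j⟩
  simp [YoungDiagram.mem_iff_lt_rowLen, h]

lemma bead_eq_of_beta_eq {lam mu : YoungDiagram} {m : ℕ} (h : beta lam m = beta mu m) :
    bead lam m = bead mu m :=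
  ((bead_strictAnti lam m).range_inj (bead_strictAnti mu m)).1 (by
    simpa [beta] using congrArg (fun s : Finset ℕ => (s : Set ℕ)) h)

lemma eq_of_beta_eq {lam mu : YoungDiagram} {m : ℕ} (hl : lam.colLen 0 ≤ m)
    (hm : mu.colLen 0 ≤ m) (h : beta lam m = beta mu m) : lam = mu := by
  refine eq_of_rowLen fun i => ?_
  by_cases hi : i < m
  · have := congrFun (bead_eq_of_beta_eq h) ⟨i, hi⟩
    simpa [bead] using this
  · rw [rowLen_eq_zero (by omega), rowLen_eq_zero (by omega)]

/-! ### Diagrams in a box -/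

/-- For a diagram in the `m × m'` box, the labels of the vertical (`inl`) and the horizontal
(`inr`) steps of its boundary path. -/
def boundaryFun (nu : YoungDiagram) (m m' : ℕ) : Fin m ⊕ Fin m' → ℕ
  | .inl i => bead nu m i
  | .inr j => m + j - nu.colLen j

lemma colLen_le {nu : YoungDiagram} {m : ℕ} (h : nu.colLen 0 ≤ m) (j : ℕ) : nu.colLen j ≤ m :=
  (nu.colLen_anti 0 j (Nat.zero_le _)).trans h

lemma rowLen_le {nu : YoungDiagram} {m : ℕ} (h : nu.rowLen 0 ≤ m) (j : ℕ) : nu.rowLen j ≤ m :=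
  (nu.rowLen_anti 0 j (Nat.zero_le _)).trans h

lemma boundaryFun_lt {nu : YoungDiagram} {m m' : ℕ} (h' : nu.rowLen 0 ≤ m')
    (x : Fin m ⊕ Fin m') : boundaryFun nu m m' x < m + m' := by
  rcases x with i | j
  · have := rowLen_le h' i
    simp only [boundaryFun, bead]
    omega
  · simp only [boundaryFun]
    omega

/-- A cell lies inside the diagram exactly when the boundary path traverses the cell's column before
its row. Hence cells are inversions of the path, the source of the sign `(-1)^|ν|`. -/
lemma boundaryFun_inl_lt_inr {nu : YoungDiagram} {m m' : ℕ} (h : nu.colLen 0 ≤ m)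
    (i : Fin m) (j : Fin m') :
    boundaryFun nu m m' (.inl i) < boundaryFun nu m m' (.inr j) ↔ ((i : ℕ), (j : ℕ)) ∉ nu := by
  rw [YoungDiagram.mem_iff_lt_rowLen]
  have h1 := lt_rowLen_iff_lt_colLen nu i j
  have h2 := colLen_le h j
  simp only [boundaryFun, bead]
  omega

lemma boundaryFun_inl_ne_inr {nu : YoungDiagram} {m m' : ℕ} (h : nu.colLen 0 ≤ m)
    (i : Fin m) (j : Fin m') :
    boundaryFun nu m m' (.inl i) ≠ boundaryFun nu m m' (.inr j) := by
  have h1 := lt_rowLen_iff_lt_colLen nu i j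
  have h2 := colLen_le h j
  simp only [boundaryFun, bead]
  omega

lemma boundaryFun_inr_lt {nu : YoungDiagram} {m m' : ℕ} (h : nu.colLen 0 ≤ m) {i j : Fin m'}
    (hij : i < j) : boundaryFun nu m m' (.inr i) < boundaryFun nu m m' (.inr j) := by
  have h1 := nu.colLen_anti i j (by exact_mod_cast hij.le)
  have h2 := colLen_le h i
  have h3 := Fin.lt_def.1 hij
  simp only [boundaryFun]
  omega

lemma boundaryFun_injective {nu : YoungDiagram} {m m' : ℕ} (h : nu.colLen 0 ≤ m) :
    Function.Injective (boundaryFun nu m m') := by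
  rintro (i | i) (j | j) hij
  · rw [(bead_strictAnti nu m).injective hij]
  · exact absurd hij (boundaryFun_inl_ne_inr h i j)
  · exact absurd hij.symm (boundaryFun_inl_ne_inr h j i)
  · rcases lt_trichotomy i j with h1 | h1 | h1
    · exact absurd hij (boundaryFun_inr_lt h h1).ne
    · rw [h1]
    · exact absurd hij (boundaryFun_inr_lt h h1).ne'

/-- The boundary path of a diagram in the `m × m'` box, as a bijection from its steps to their
labels. -/
noncomputable def boundaryEquiv (nu : YoungDiagram) {m m' : ℕ} (h : nu.colLen 0 ≤ m)
    (h' : nu.rowLen 0 ≤ m') : Fin m ⊕ Fin m' ≃ Fin (m + m') :=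
  Equiv.ofBijective (fun x => ⟨boundaryFun nu m m' x, boundaryFun_lt h' x⟩) (by
    rw [Fintype.bijective_iff_injective_and_card]
    exact ⟨fun x y hxy => boundaryFun_injective h (congrArg Fin.val hxy), by simp⟩)

lemma boundaryEquiv_val (nu : YoungDiagram) {m m' : ℕ} (h : nu.colLen 0 ≤ m)
    (h' : nu.rowLen 0 ≤ m') (x : Fin m ⊕ Fin m') :
    (boundaryEquiv nu h h' x : ℕ) = boundaryFun nu m m' x := rfl

lemma colLen_bot (j : ℕ) : (⊥ : YoungDiagram).colLen j = 0 := by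
  by_contra h
  have := YoungDiagram.mem_iff_lt_colLen.2 (Nat.pos_of_ne_zero h)
  simp at this

lemma rowLen_bot (i : ℕ) : (⊥ : YoungDiagram).rowLen i = 0 := by
  by_contra h
  have := YoungDiagram.mem_iff_lt_rowLen.2 (Nat.pos_of_ne_zero h)
  simp at this

lemma prod_box_eq {nu : YoungDiagram} {m m' : ℕ} (h : nu.colLen 0 ≤ m) (h' : nu.rowLen 0 ≤ m') :
    (∏ i : Fin m, ∏ j : Fin m', if ((i : ℕ), (j : ℕ)) ∉ nu then (1 : ℤ) else -1) =
      (-1) ^ nu.card := by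
  have hc : nu.cells = (Finset.range m ×ˢ Finset.range m').filter fun c => c ∈ nu := by
    ext ⟨i, j⟩
    simp only [YoungDiagram.mem_cells, Finset.mem_filter, Finset.mem_product, Finset.mem_range]
    refine ⟨fun hij => ⟨⟨?_, ?_⟩, hij⟩, fun hij => hij.2⟩
    · exact (YoungDiagram.mem_iff_lt_colLen.1 hij).trans_le (colLen_le h j)
    · exact (YoungDiagram.mem_iff_lt_rowLen.1 hij).trans_le (rowLen_le h' i)
  rw [YoungDiagram.card, hc, ← Finset.prod_const, Finset.prod_filter, Finset.prod_product,
    ← Fin.prod_univ_eq_prod_range (fun i => ∏ j ∈ Finset.range m', if (i, j) ∈ nu then (-1 : ℤ) else 1)]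
  refine Finset.prod_congr rfl fun i _ => ?_
  rw [← Fin.prod_univ_eq_prod_range (fun j => if ((i : ℕ), j) ∈ nu then (-1 : ℤ) else 1)]
  refine Finset.prod_congr rfl fun j _ => ?_
  by_cases hij : ((i : ℕ), (j : ℕ)) ∈ nu <;> simp [hij]

/-- For the empty diagram all vertical steps precede all horizontal ones. Within each family the
order of the labels is the same for every diagram, so the discordant pairs are the cells of `nu`. -/
lemma orderSign_boundary {nu : YoungDiagram} {m m' : ℕ} (h : nu.colLen 0 ≤ m)
    (h' : nu.rowLen 0 ≤ m') (hb : (⊥ : YoungDiagram).colLen 0 ≤ m)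
    (hb' : (⊥ : YoungDiagram).rowLen 0 ≤ m') :
    orderSign (toLex : Fin m ⊕ Fin m' → _) (boundaryEquiv ⊥ hb hb') (boundaryEquiv nu h h') =
      (-1) ^ nu.card := by
  rw [← prod_box_eq h h']
  simp only [orderSign, Fin.lt_def, boundaryEquiv_val, Fintype.prod_sum_type]
  have e1 : ∀ mu : YoungDiagram, ∀ i j : Fin m,
      boundaryFun mu m m' (.inl i) < boundaryFun mu m m' (.inl j) ↔ j < i :=
    fun mu i j => bead_lt_iff mu m
  have e2 : ∀ {mu : YoungDiagram}, mu.colLen 0 ≤ m → ∀ {i j : Fin m'}, i < j →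
      boundaryFun mu m m' (.inr i) < boundaryFun mu m m' (.inr j) :=
    fun h _ _ hij => boundaryFun_inr_lt h hij
  have e3 : ∀ (i : Fin m) (j : Fin m'),
      boundaryFun ⊥ m m' (.inl i) < boundaryFun ⊥ m m' (.inr j) := fun i j => by
    rw [boundaryFun_inl_lt_inr hb]; simp
  simp only [e1, e3, boundaryFun_inl_lt_inr h, Sum.Lex.inl_lt_inl_iff, Sum.Lex.inl_lt_inr,
    Sum.Lex.not_inr_lt_inl, Sum.Lex.inr_lt_inr_iff, if_true, if_false, true_iff,
    Finset.prod_const_one, ite_self, one_mul]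
  rw [Finset.prod_eq_one (s := (Finset.univ : Finset (Fin m'))), mul_one]
  intro i _
  refine Finset.prod_eq_one fun j _ => ?_
  split_ifs with h1 h2
  · rfl
  · exact absurd (iff_of_true (e2 hb h1) (e2 h h1)) h2
  · rfl

/-- The labels missed by the vertical steps are those of the horizontal steps, and reading the path
backwards turns them into the beads of the conjugate. The hypothesis `hs` encodes this reversal `s'
= m + m' - 1 - s`. -/
lemma mem_beta_transpose {nu : YoungDiagram} {m m' : ℕ} (h : nu.colLen 0 ≤ m)
    (h' : nu.rowLen 0 ≤ m') {s s' : ℕ} (hs : s + s' + 1 = m + m') :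
    s ∈ beta nu.transpose m' ↔ s' ∉ beta nu m := by
  have hb : ∀ j : Fin m', bead nu.transpose m' j + boundaryFun nu m m' (.inr j) + 1 = m + m' := by
    intro j
    have := colLen_le h j
    simp only [bead, boundaryFun, YoungDiagram.rowLen_transpose]
    omega
  simp only [mem_beta]
  constructor
  · rintro ⟨j, hj⟩ ⟨i, hi⟩
    have h1 := hb j
    have h2 := boundaryFun_inl_ne_inr (m' := m') h i j
    simp only [boundaryFun] at h1 h2
    omega
  · intro hn
    obtain ⟨x, hx⟩ := (boundaryEquiv nu h h').surjective ⟨s', by omega⟩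
    have hx := congrArg Fin.val hx
    rw [boundaryEquiv_val] at hx
    rcases x with i | j
    · exact absurd ⟨i, hx⟩ hn
    · exact ⟨j, by have := hb j; simp only at hx; omega⟩

/-! ### Determinants of larger size for skew Schur functions and odd orthogonal characters -/

lemma hInt_of_neg {r : ℤ} (h : r < 0) : hInt r = 0 := by
  rw [hInt, if_neg (by omega)]

lemma hInt_zero : hInt 0 = 1 := by
  simp [hInt, hNat_zero]

lemma rowLen_mono {lam mu : YoungDiagram} (h : mu ≤ lam) (i : ℕ) : mu.rowLen i ≤ lam.rowLen i := by
  by_contra! hi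
  have h1 : (i, lam.rowLen i) ∈ lam := h (YoungDiagram.mem_iff_lt_rowLen.2 hi)
  exact absurd (YoungDiagram.mem_iff_lt_rowLen.1 h1) (lt_irrefl _)

theorem skewSchur_eq_det {lam mu : YoungDiagram} {m : ℕ} (hl : lam.colLen 0 ≤ m)
    (hm : mu.colLen 0 ≤ m) :
    skewSchur lam mu =
      (Matrix.of fun i j : Fin m => hInt ((bead lam m i : ℤ) - bead mu m j)).det := by
  classical
  rw [skewSchur]
  split_ifs with h
  · have := det_castLE hl (fun i j => hInt ((lam.rowLen i : ℤ) - mu.rowLen j - i + j))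
      (fun i j hi hj => hInt_of_neg (by rw [rowLen_eq_zero hi]; omega))
      (fun i hi => by
        have h1 := rowLen_mono h i
        rw [rowLen_eq_zero hi] at h1 ⊢
        rw [Nat.le_zero.1 h1, ← hInt_zero]
        congr 1
        omega)
    refine this.symm.trans (congrArg Matrix.det ?_)
    ext1 i j
    simp only [Matrix.of_apply, bead]
    congr 1
    omega
  · by_contra hdet
    obtain ⟨σ, hσ⟩ := exists_perm_of_det_ne_zero (Ne.symm hdet)
    -- In a row `a` where `mu` is longer than `lam`, the bead of `lam` is the smaller one. The `a +
    -- 1` columns up to `a` then have nonzero entries only in the `a` rows above `a`, so no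
    -- transversal exists.
    obtain ⟨⟨a, b⟩, hab, hab'⟩ : ∃ c, c ∈ mu ∧ c ∉ lam := by
      by_contra! hc
      exact h fun c hc' => hc c hc'
    rw [YoungDiagram.mem_iff_lt_rowLen] at hab hab'
    have ha : a < m := by
      have := (lt_rowLen_iff_lt_colLen mu a b).1 hab
      have := colLen_le hm b
      omega
    have hmaps : Set.MapsTo σ (Finset.Iic (⟨a, ha⟩ : Fin m)) (Finset.Iio (⟨a, ha⟩ : Fin m)) := by
      intro j hj
      have hj : j ≤ ⟨a, ha⟩ := by simpa using hj
      have h1 : 0 ≤ (bead lam m (σ j) : ℤ) - bead mu m j := by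
        by_contra! hneg
        exact hσ j (hInt_of_neg hneg)
      have h2 := (bead_strictAnti mu m).antitone hj
      have h3 : bead lam m ⟨a, ha⟩ < bead mu m ⟨a, ha⟩ := by
        simp only [bead]
        omega
      have h4 : bead lam m ⟨a, ha⟩ < bead lam m (σ j) := by omega
      simpa using (bead_lt_iff lam m).1 h4
    have := Finset.card_le_card_of_injOn σ hmaps σ.injective.injOn
    rw [Fin.card_Iic, Fin.card_Iio] at this
    simp at this

theorem so_eq_det {lam : YoungDiagram} {m : ℕ} (hl : lam.colLen 0 ≤ m) :
    so lam = (Matrix.of fun i j : Fin m =>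
      hInt ((bead lam m i : ℤ) + 1 + j - m) + hInt ((bead lam m i : ℤ) - m - j)).det := by
  have := det_castLE hl (fun i j => hInt ((lam.rowLen i : ℤ) - (i + 1) + (j + 1)) +
      hInt ((lam.rowLen i : ℤ) - (i + 1) - (j + 1) + 1))
      (fun i j hi hj => by
        rw [hInt_of_neg, hInt_of_neg, add_zero] <;> rw [rowLen_eq_zero hi] <;> omega)
      (fun i hi => by
        rw [rowLen_eq_zero hi, hInt_of_neg (r := _ - _ + 1) (by omega), add_zero, ← hInt_zero]
        congr 1
        omega)
  refine this.symm.trans (congrArg Matrix.det ?_)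
  ext1 i j
  simp only [Matrix.of_apply, bead]
  congr 2 <;> omega

/-! ### The determinantal formula for `rs` -/

/-- The matrix of Koike's determinant for `rs_{λ,μ}`, with columns indexed by step labels. -/
noncomputable def rsAux (lam mu : YoungDiagram) (m m' : ℕ) :
    Fin m ⊕ Fin m' → ℕ → SymFun
  | .inl i, s => hInt ((bead lam m i : ℤ) - s)
  | .inr i, s => hInt ((bead mu m' i : ℤ) - ((m : ℤ) + m' - 1 - s))

/-- Laplace expansion along the first `m` rows, the sets of `m` columns being parametrized by the
diagrams in the `m × m'` box. -/
lemma det_laplace {R : Type*} [CommRing R] {m m' : ℕ} (M : Fin m ⊕ Fin m' → ℕ → R)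
    (B : Finset YoungDiagram)
    (hB : ∀ nu, nu ∈ B ↔ nu.colLen 0 ≤ m ∧ nu.rowLen 0 ≤ m') (f : Fin m ⊕ Fin m' ≃ Fin (m + m')) :
    (Matrix.of fun x y => M x (f y)).det =
      ∑ nu ∈ B, (Matrix.of fun x y =>
        if (x.isLeft ↔ (f y : ℕ) ∈ beta nu m) then M x (f y) else 0).det := by
  classical
  -- Transposing makes each term a product over rows `x` with column `σ x`.
  simp only [← Matrix.det_transpose (Matrix.of _), Matrix.det_apply']
  rw [Finset.sum_comm]
  refine Finset.sum_congr rfl fun σ _ => ?_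
  rw [← Finset.mul_sum]
  congr 1
  simp only [Matrix.transpose_apply, Matrix.of_apply]
  -- The columns that `σ` assigns to the first `m` rows. Only the diagram with beta set `S` keeps
  -- this term of the expansion.
  set S : Finset ℕ := Finset.univ.image fun i : Fin m => (f (σ (.inl i)) : ℕ) with hS
  have hinj : Function.Injective fun i : Fin m => (f (σ (.inl i)) : ℕ) :=
    Fin.val_injective.comp (f.injective.comp (σ.injective.comp Sum.inl_injective))
  have hcard : S.card = m := by
    rw [hS, Finset.card_image_of_injective _ hinj]; simp
  have hbeta : beta (ofBeta S) m = S := by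
    conv_lhs => rw [← hcard]
    exact beta_ofBeta S
  have hcol : (ofBeta S).colLen 0 ≤ m := (colLen_ofBeta S).trans_eq hcard
  have hmem : ofBeta S ∈ B := by
    rw [hB]
    refine ⟨hcol, ?_⟩
    rcases Nat.eq_zero_or_pos m with hm | hm
    · rw [rowLen_eq_zero (by omega)]; simp
    · have : bead (ofBeta S) m ⟨0, hm⟩ ∈ beta (ofBeta S) m := mem_beta.2 ⟨_, rfl⟩
      rw [hbeta] at this
      obtain ⟨i, -, hi⟩ := Finset.mem_image.1 this
      have := (f (σ (.inl i))).isLt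
      simp only [bead] at hi
      omega
  rw [Finset.sum_eq_single_of_mem _ hmem]
  · refine Finset.prod_congr rfl fun x _ => ?_
    rw [if_pos]
    rw [hbeta]
    rcases x with i | j
    · simp [hS]
    · simp [hS, Fin.val_inj]
  · intro nu hnu hne
    by_contra hprod
    apply hne
    refine eq_of_beta_eq ((hB nu).1 hnu).1 hcol ?_
    rw [hbeta]
    symm
    apply Finset.eq_of_subset_of_card_le
    · intro s hs
      obtain ⟨i, -, rfl⟩ := Finset.mem_image.1 hs
      by_contra hns
      apply hprod
      exact Finset.prod_eq_zero (Finset.mem_univ (Sum.inl i)) (by simp [hns])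
    · rw [card_beta, hcard]

lemma finite_box (m m' : ℕ) :
    {nu : YoungDiagram | nu.colLen 0 ≤ m ∧ nu.rowLen 0 ≤ m'}.Finite := by
  refine Set.Finite.of_finite_image (f := YoungDiagram.cells)
    (((Finset.range m ×ˢ Finset.range m').powerset.finite_toSet).subset ?_)
    fun a _ b _ hab => YoungDiagram.ext hab
  rintro _ ⟨nu, ⟨h, h'⟩, rfl⟩
  refine Finset.mem_coe.2 (Finset.mem_powerset.2 ?_)
  rintro ⟨i, j⟩ hij
  rw [YoungDiagram.mem_cells] at hij
  simp only [Finset.mem_product, Finset.mem_range]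
  exact ⟨(YoungDiagram.mem_iff_lt_colLen.1 hij).trans_le (colLen_le h j),
    (YoungDiagram.mem_iff_lt_rowLen.1 hij).trans_le (rowLen_le h' i)⟩

lemma colLen_mono {lam mu : YoungDiagram} (h : mu ≤ lam) (i : ℕ) : mu.colLen i ≤ lam.colLen i := by
  simpa using rowLen_mono (YoungDiagram.transpose_mono h) i

/-- In the Laplace expansion the term of `nu` becomes block diagonal once its columns are listed
along the boundary path of `nu`. The blocks are the padded determinants of the two skew Schur
functions, since the complementary columns, reflected, are the beads of `nu.transpose`; the
reordering costs `(-1)^|ν|`. -/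
theorem rs_eq_det {lam mu : YoungDiagram} {m m' : ℕ} (hl : lam.colLen 0 ≤ m)
    (hm : mu.colLen 0 ≤ m') :
    rs lam mu = (Matrix.of fun x y : Fin m ⊕ Fin m' =>
      rsAux lam mu m m' x (boundaryFun ⊥ m m' y)).det := by
  classical
  have hb : (⊥ : YoungDiagram).colLen 0 ≤ m := by simp [colLen_bot]
  have hb' : (⊥ : YoungDiagram).rowLen 0 ≤ m' := by simp [rowLen_bot]
  set B := (finite_box m m').toFinset
  have hB : ∀ nu, nu ∈ B ↔ nu.colLen 0 ≤ m ∧ nu.rowLen 0 ≤ m' := by simp [B]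
  have hL := det_laplace (rsAux lam mu m m') B hB (boundaryEquiv ⊥ hb hb')
  refine Eq.trans ?_ hL.symm
  rw [rs, finsum_eq_sum_of_support_subset (s := B)]
  · refine Finset.sum_congr rfl fun nu hnu => ?_
    obtain ⟨h, h'⟩ := (hB nu).1 hnu
    have hinjk : Function.Injective (toLex : Fin m ⊕ Fin m' → _) := toLex.injective
    set M : Matrix (Fin (m + m')) (Fin (m + m')) SymFun := Matrix.of fun u v =>
      if (((boundaryEquiv ⊥ hb hb').symm u).isLeft ↔ (v : ℕ) ∈ beta nu m) then
        rsAux lam mu m m' ((boundaryEquiv ⊥ hb hb').symm u) v else 0 with hM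
    have h2 := det_submatrix_equiv M (boundaryEquiv ⊥ hb hb') (boundaryEquiv nu h h') hinjk
    rw [orderSign_boundary h h' hb hb'] at h2
    have h3 : (Matrix.of fun x y : Fin m ⊕ Fin m' =>
        if (x.isLeft ↔ (boundaryEquiv ⊥ hb hb' y : ℕ) ∈ beta nu m) then
          rsAux lam mu m m' x (boundaryEquiv ⊥ hb hb' y) else 0).det = M.det := by
      rw [← Matrix.det_submatrix_equiv_self (boundaryEquiv ⊥ hb hb') M]
      congr 1
      ext1 x y
      simp [hM]
    have h4 : M.submatrix (boundaryEquiv ⊥ hb hb') (boundaryEquiv nu h h') =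
        Matrix.fromBlocks
          (Matrix.of fun i j : Fin m => hInt ((bead lam m i : ℤ) - bead nu m j)) 0 0
          (Matrix.of fun i j : Fin m' =>
            hInt ((bead mu m' i : ℤ) - bead nu.transpose m' j)) := by
      have e1 : ∀ i, bead nu m i ∈ beta nu m := fun i => mem_beta.2 ⟨i, rfl⟩
      have e2 : ∀ j : Fin m', m + (j : ℕ) - nu.colLen j ∉ beta nu m := fun j hj => by
        obtain ⟨i, hi⟩ := mem_beta.1 hj
        exact boundaryFun_inl_ne_inr h i j hi
      ext1 (i | i) (j | j)
      · simp [hM, boundaryEquiv_val, boundaryFun, e1, rsAux]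
      · simp [hM, boundaryEquiv_val, boundaryFun, e2]
      · simp [hM, boundaryEquiv_val, boundaryFun, e1]
      · simp only [hM, Matrix.submatrix_apply, Matrix.of_apply, Equiv.symm_apply_apply,
          boundaryEquiv_val, boundaryFun, e2, Sum.isLeft_inr, Bool.false_eq_true, iff_self,
          if_true, rsAux, Matrix.fromBlocks_apply₂₂]
        have := colLen_le h j
        congr 1
        simp only [bead, YoungDiagram.rowLen_transpose]
        omega
    rw [h4, Matrix.det_fromBlocks_zero₂₁, ← skewSchur_eq_det hl h,
      ← skewSchur_eq_det hm (by simpa using h')] at h2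
    rw [h3, mul_assoc, h2, ← mul_assoc]
    push_cast
    rw [← mul_pow]
    simp
  · intro nu hnu
    rw [Function.mem_support] at hnu
    have hl' : nu ≤ lam := by
      by_contra hle
      apply hnu
      simp [skewSchur, hle]
    have hm' : nu.transpose ≤ mu := by
      by_contra hle
      apply hnu
      simp [skewSchur, hle]
    refine Finset.mem_coe.2 ((hB nu).2 ⟨(colLen_mono hl' 0).trans hl, ?_⟩)
    have := colLen_mono hm' 0
    rw [YoungDiagram.colLen_transpose] at this
    exact this.trans hm

/-! ### Residue classes of beads -/

lemma mul_add_mod_self {a r : ℕ} (hr : r < a) (q : ℕ) : (q * a + r) % a = r := by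
  rw [Nat.add_comm, Nat.add_mul_mod_self_right, Nat.mod_eq_of_lt hr]

lemma mul_add_div_self {a r : ℕ} (hr : r < a) (q : ℕ) : (q * a + r) / a = q := by
  rw [Nat.mul_comm, Nat.mul_add_div (by omega), Nat.div_eq_of_lt hr, add_zero]

lemma mul_add_inj {a q q' r r' : ℕ} (hr : r < a) (hr' : r' < a) :
    q * a + r = q' * a + r' ↔ q = q' ∧ r = r' := by
  refine ⟨fun h => ⟨?_, ?_⟩, fun h => by rw [h.1, h.2]⟩
  · rw [← mul_add_div_self hr q, h, mul_add_div_self hr']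
  · rw [← mul_add_mod_self hr q, h, mul_add_mod_self hr']

lemma mul_add_lt {a q r n : ℕ} (hr : r < a) (hq : q < n) : q * a + r < n * a := by
  calc q * a + r < q * a + a := by omega
    _ = (q + 1) * a := by ring
    _ ≤ n * a := Nat.mul_le_mul_right _ hq

lemma le_mul_add_iff {a q r n : ℕ} (hr : r < a) : n * a ≤ q * a + r ↔ n ≤ q := by
  refine ⟨fun h => ?_, fun h => (Nat.mul_le_mul_right _ h).trans (Nat.le_add_right _ _)⟩
  by_contra! hq
  exact absurd (mul_add_lt hr hq) (by omega)

lemma mr_eq_card (t : ℕ) (lam : YoungDiagram) (N r : ℕ) :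
    mr t lam N r = (Finset.univ.filter fun i : Fin N => bead lam N i % t = r).card := by
  rw [mr, beta, Finset.filter_image,
    Finset.card_image_of_injective _ (bead_strictAnti lam N).injective]

lemma card_fin_mod_eq {n t r : ℕ} (hr : r < t) :
    (Finset.univ.filter fun j : Fin (n * t) => (j : ℕ) % t = r).card = n := by
  have : (Finset.univ.filter fun j : Fin (n * t) => (j : ℕ) % t = r) =
      Finset.univ.image fun k : Fin n => (⟨k * t + r, mul_add_lt hr k.isLt⟩ : Fin (n * t)) := by
    ext j
    simp only [Finset.mem_filter, Finset.mem_univ, true_and, Finset.mem_image, Fin.ext_iff]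
    constructor
    · rintro rfl
      exact ⟨⟨j / t, Nat.div_lt_of_lt_mul (j.isLt.trans_eq (Nat.mul_comm _ _))⟩,
        Nat.div_add_mod' _ _⟩
    · rintro ⟨k, hk⟩
      rw [← hk, mul_add_mod_self hr]
  rw [this, Finset.card_image_of_injective]
  · simp
  · intro k k' h
    have := (mul_add_inj hr hr).1 (congrArg Fin.val h)
    exact Fin.ext this.1

lemma sum_mr {t : ℕ} (ht : 0 < t) (lam : YoungDiagram) (N : ℕ) :
    ∑ r ∈ Finset.range t, mr t lam N r = N := by
  simp only [mr_eq_card]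
  rw [← Finset.card_eq_sum_card_fiberwise]
  · simp
  · intro i _
    simpa using Nat.mod_lt _ ht

/-! ### Quotient and core -/

lemma card_quotBeads (t : ℕ) (lam : YoungDiagram) (N r : ℕ) :
    (((beta lam N).filter fun x => x % t = r).image fun x => x / t).card = mr t lam N r := by
  rw [mr, Finset.card_image_of_injOn]
  intro x hx y hy hxy
  simp only [Finset.coe_filter, Set.mem_ofPred_eq] at hx hy hxy
  rw [← Nat.div_add_mod x t, ← Nat.div_add_mod y t, hxy, hx.2, hy.2]

lemma colLen_quot (t : ℕ) (lam : YoungDiagram) (N r : ℕ) :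
    (quot t lam N r).colLen 0 ≤ mr t lam N r :=
  (colLen_ofBeta _).trans_eq (card_quotBeads t lam N r)

lemma beta_quot (t : ℕ) (lam : YoungDiagram) (N r : ℕ) :
    beta (quot t lam N r) (mr t lam N r) =
      ((beta lam N).filter fun x => x % t = r).image fun x => x / t := by
  rw [← card_quotBeads]
  exact beta_ofBeta _

lemma mem_beta_quot {t r : ℕ} (hr : r < t) (lam : YoungDiagram) (N x : ℕ) :
    x ∈ beta (quot t lam N r) (mr t lam N r) ↔ x * t + r ∈ beta lam N := by
  rw [beta_quot]
  simp only [Finset.mem_image, Finset.mem_filter]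
  constructor
  · rintro ⟨y, ⟨hy, rfl⟩, rfl⟩
    rwa [Nat.div_add_mod']
  · intro h
    exact ⟨_, ⟨h, mul_add_mod_self hr x⟩, mul_add_div_self hr x⟩

/-- The beta set with `m r` beads on the runner `r < t`, all pushed to the top. -/
def coreBeads (t : ℕ) (m : ℕ → ℕ) : Finset ℕ :=
  (Finset.range t).biUnion fun r => (Finset.range (m r)).image fun k => k * t + r

lemma mem_coreBeads {t r : ℕ} (hr : r < t) (m : ℕ → ℕ) (k : ℕ) :
    k * t + r ∈ coreBeads t m ↔ k < m r := by
  simp only [coreBeads, Finset.mem_biUnion, Finset.mem_range, Finset.mem_image]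
  constructor
  · rintro ⟨r', hr', k', hk', h⟩
    obtain ⟨rfl, rfl⟩ := (mul_add_inj hr' hr).1 h
    exact hk'
  · intro h
    exact ⟨r, hr, k, h, rfl⟩

lemma card_filter_coreBeads (t n : ℕ) (m : ℕ → ℕ) :
    ((coreBeads t m).filter fun x => n * t ≤ x).card = ∑ r ∈ Finset.range t, (m r - n) := by
  have : ((coreBeads t m).filter fun x => n * t ≤ x) =
      (Finset.range t).biUnion fun r => (Finset.Ico n (m r)).image fun k => k * t + r := by
    ext x
    simp only [coreBeads, Finset.mem_biUnion, Finset.mem_range, Finset.mem_image,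
      Finset.mem_filter, Finset.mem_Ico]
    constructor
    · rintro ⟨⟨r, hr, k, hk, rfl⟩, h⟩
      exact ⟨r, hr, k, ⟨(le_mul_add_iff hr).1 h, hk⟩, rfl⟩
    · rintro ⟨r, hr, k, ⟨hk, hk'⟩, rfl⟩
      exact ⟨⟨r, hr, k, hk', rfl⟩, (le_mul_add_iff hr).2 hk⟩
  rw [this, Finset.card_biUnion]
  · refine Finset.sum_congr rfl fun r hr => ?_
    rw [Finset.card_image_of_injective, Nat.card_Ico]
    intro k k' h
    have hr := Finset.mem_range.1 hr
    exact ((mul_add_inj hr hr).1 h).1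
  · intro r hr r' hr' hne
    rw [Function.onFun, Finset.disjoint_left]
    intro x hx hx'
    obtain ⟨k, -, rfl⟩ := Finset.mem_image.1 hx
    obtain ⟨k', -, h⟩ := Finset.mem_image.1 hx'
    exact hne ((mul_add_inj (Finset.mem_range.1 hr') (Finset.mem_range.1 hr)).1 h).2.symm

lemma card_coreBeads (t : ℕ) (m : ℕ → ℕ) : (coreBeads t m).card = ∑ r ∈ Finset.range t, m r := by
  simpa using card_filter_coreBeads t 0 m

lemma card_coreBeads_mr {t : ℕ} (ht : 0 < t) (lam : YoungDiagram) (N : ℕ) :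
    (coreBeads t (mr t lam N)).card = N := by
  rw [card_coreBeads, sum_mr ht]

lemma colLen_core {t : ℕ} (ht : 0 < t) (lam : YoungDiagram) (N : ℕ) :
    (core t lam N).colLen 0 ≤ N :=
  (colLen_ofBeta _).trans_eq (card_coreBeads_mr ht lam N)

lemma beta_core {t : ℕ} (ht : 0 < t) (lam : YoungDiagram) (N : ℕ) :
    beta (core t lam N) N = coreBeads t (mr t lam N) := by
  have := beta_ofBeta (coreBeads t (mr t lam N))
  rwa [card_coreBeads_mr ht lam N] at this

/-- With indices from `0`, row `i` contains its diagonal cell iff `λ_i ≥ i + 1`, that is, iff its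
bead `λ_i + N - 1 - i` is at least `N`. -/
lemma rk_eq_card {lam : YoungDiagram} {N : ℕ} (h : lam.colLen 0 ≤ N) :
    rk lam = ((beta lam N).filter fun x => N ≤ x).card := by
  rw [beta, Finset.filter_image,
    Finset.card_image_of_injective _ (bead_strictAnti lam N).injective, rk]
  symm
  refine Finset.card_bij (fun i _ => ((i : ℕ), (i : ℕ))) ?_ ?_ ?_
  · intro i hi
    replace hi := (Finset.mem_filter.1 hi).2
    have h1 := i.isLt
    simp only [bead] at hi
    simp only [Finset.mem_filter, YoungDiagram.mem_cells, YoungDiagram.mem_iff_lt_rowLen]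
    exact ⟨by omega, trivial⟩
  · intro i _ j _ hij
    exact Fin.ext (congrArg Prod.fst hij)
  · rintro ⟨i, j⟩ hij
    simp only [Finset.mem_filter, YoungDiagram.mem_cells] at hij
    obtain ⟨hij, rfl⟩ := hij
    have h1 := (YoungDiagram.mem_iff_lt_colLen.1 hij).trans_le (colLen_le h _)
    have h2 := YoungDiagram.mem_iff_lt_rowLen.1 hij
    refine ⟨⟨i, h1⟩, Finset.mem_filter.2 ⟨Finset.mem_univ _, ?_⟩, rfl⟩
    simp only [bead]
    omega

lemma rk_core {t : ℕ} (ht : 0 < t) (lam : YoungDiagram) (n : ℕ) :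
    rk (core t lam (n * t)) = ∑ r ∈ Finset.range t, (mr t lam (n * t) r - n) := by
  rw [rk_eq_card (colLen_core ht lam _), beta_core ht, card_filter_coreBeads]

/-- Conjugation reflects and complements the bead set in the window `[0, 2nt)`. A flush runner `r`
with `m_r` beads becomes a flush runner `t - 1 - r` with `2n - m_r` beads, so invariance is a
condition on the counts alone. -/
theorem transpose_core_eq_iff {t : ℕ} (ht : 0 < t) (lam : YoungDiagram) (n : ℕ) :
    (core t lam (n * t)).transpose = core t lam (n * t) ↔
      ∀ r < t, mr t lam (n * t) r + mr t lam (n * t) (t - 1 - r) = 2 * n := by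
  have hcol := colLen_core ht lam (n * t)
  have hbeta := beta_core ht lam (n * t)
  set c := core t lam (n * t)
  set m := mr t lam (n * t)
  -- The reflection `x ↦ 2nt - 1 - x` sends position `k` on runner `r` to position `2n - 1 - k` on
  -- runner `t - 1 - r`.
  have hrefl : ∀ r k, r < t → k < 2 * n →
      (2 * n - 1 - k) * t + (t - 1 - r) + (k * t + r) + 1 = n * t + n * t := by
    intro r k hr hk
    obtain ⟨d, hd⟩ := Nat.exists_eq_add_of_lt hk
    have h1 : 2 * n - 1 - k = d := by omega
    have h2 : n * t + n * t = 2 * n * t := by ring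
    rw [h1, h2, hd]
    have h3 : (k + d + 1) * t = k * t + d * t + t := by ring
    rw [h3]
    omega
  have hrow : c.rowLen 0 ≤ n * t ↔ ∀ x ∈ coreBeads t m, x < n * t + n * t := by
    rw [← hbeta]
    constructor
    · intro h x hx
      obtain ⟨i, rfl⟩ := mem_beta.1 hx
      have := rowLen_le h i
      simp only [bead]
      omega
    · intro h
      rcases Nat.eq_zero_or_pos (n * t) with h0 | h0
      · rw [rowLen_eq_zero (by omega)]; simp
      · have := h _ (mem_beta.2 ⟨⟨0, h0⟩, rfl⟩)
        simp only [bead] at this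
        omega
  constructor
  · intro hself r hr
    have hrow0 : c.rowLen 0 ≤ n * t := by
      rw [← YoungDiagram.colLen_transpose, hself]
      exact hcol
    have hr' : t - 1 - r < t := by omega
    have key : ∀ k < 2 * n, k < m r ↔ ¬ (2 * n - 1 - k < m (t - 1 - r)) := by
      intro k hk
      rw [← mem_coreBeads hr, ← mem_coreBeads hr', ← hbeta,
        ← mem_beta_transpose hcol hrow0 (s := k * t + r) (by have := hrefl r k hr hk; omega), hself]
    -- A runner with more than `2n` beads would have one at `2nt + r`, outside the window.
    have hle : m r ≤ 2 * n := by
      by_contra! hlt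
      have := hrow.1 hrow0 _ ((mem_coreBeads hr m (2 * n)).2 hlt)
      have : 2 * n * t = n * t + n * t := by ring
      omega
    by_contra hne
    rcases Nat.lt_or_gt_of_ne hne with h | h
    · have := key (m r) (by omega)
      omega
    · have := key (m r - 1)
      have hle' : m (t - 1 - r) ≤ 2 * n := by
        by_contra! hlt
        have := hrow.1 hrow0 _ ((mem_coreBeads hr' m (2 * n)).2 hlt)
        have : 2 * n * t = n * t + n * t := by ring
        omega
      omega
  · intro hm
    have hrow0 : c.rowLen 0 ≤ n * t := by
      rw [hrow]
      intro x hx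
      rw [← Nat.div_add_mod' x t, mem_coreBeads (Nat.mod_lt _ ht)] at hx
      have h1 := hm _ (Nat.mod_lt x ht)
      have := mul_add_lt (Nat.mod_lt x ht) (show x / t < 2 * n by omega)
      rw [Nat.div_add_mod'] at this
      linarith
    refine eq_of_beta_eq (m := n * t) (by simpa using hrow0) hcol ?_
    ext x
    rw [← Nat.div_add_mod' x t]
    have hr := Nat.mod_lt x ht
    set r := x % t
    set k := x / t
    have hmr := hm r hr
    by_cases hk : k < 2 * n
    · rw [mem_beta_transpose hcol hrow0 (s' := (2 * n - 1 - k) * t + (t - 1 - r))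
        (by have := hrefl r k hr hk; omega), hbeta, mem_coreBeads hr, mem_coreBeads (by omega)]
      omega
    · have h1 : k * t + r ∉ coreBeads t m := by
        rw [mem_coreBeads hr]; omega
      rw [hbeta]
      refine iff_of_false (fun hx => ?_) h1
      obtain ⟨i, hi⟩ := mem_beta.1 hx
      have h2 := colLen_le hcol i
      have h3 := (le_mul_add_iff hr).2 (not_lt.1 hk)
      have h4 : 2 * n * t = n * t + n * t := by ring
      simp only [bead, YoungDiagram.rowLen_transpose] at hi
      omega

/-! ### The matrix of `φ_t so_λ` -/

/-- The image under `φ_t` of the entry of the determinant `so_λ` in the row of the bead `b` and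
the column `z`. -/
noncomputable def phiEntry (t n : ℕ) (b : ℕ) (z : ℤ) : SymFun :=
  phi t (hInt ((b : ℤ) + 1 + z - (n * t : ℕ))) + phi t (hInt ((b : ℤ) - (n * t : ℕ) - z))

/-- The reflection exchanges the two summands. A negative label `z` may therefore stand for the
actual column `-1 - z`, which is why `phiEntry` takes integer columns. -/
lemma phiEntry_neg (t n b : ℕ) (z : ℤ) : phiEntry t n b (-1 - z) = phiEntry t n b z := by
  rw [phiEntry, phiEntry, add_comm]
  congr 3 <;> ring

lemma phi_hInt_mul_add {t : ℕ} {d : ℤ} (hd : |d| < t) (q : ℤ) :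
    phi t (hInt (q * t + d)) = if d = 0 then hInt q else 0 := by
  have ht : (0 : ℤ) < t := (abs_nonneg d).trans_lt hd
  rw [phi_hInt (by exact_mod_cast ht)]
  by_cases h : d = 0
  · subst h
    simp [Int.mul_ediv_cancel _ ht.ne']
  · rw [if_neg h, if_neg]
    rw [Int.dvd_add_right (Dvd.intro_left _ rfl)]
    exact fun h' => h (Int.eq_zero_of_abs_lt_dvd h' hd)

lemma phiEntry_eq {t r s : ℕ} (hr : r < t) (hs : s < t) (n x : ℕ) (c : ℤ) :
    phiEntry t n (x * t + r) (c * t + (t - 1 - s)) =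
      (if r = s then hInt ((x : ℤ) + c + 1 - n) else 0) +
        if r + s + 1 = t then hInt ((x : ℤ) - n - c) else 0 := by
  have e1 : ((x * t + r : ℕ) : ℤ) + 1 + (c * t + (t - 1 - s)) - (n * t : ℕ) =
      ((x : ℤ) + c + 1 - n) * t + (r - s) := by push_cast; ring
  have e2 : ((x * t + r : ℕ) : ℤ) - (n * t : ℕ) - (c * t + (t - 1 - s)) =
      ((x : ℤ) - n - c) * t + (r + s + 1 - t) := by push_cast; ring
  rw [phiEntry, e1, e2, phi_hInt_mul_add (by rw [abs_lt]; omega),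
    phi_hInt_mul_add (by rw [abs_lt]; omega)]
  congr 1
  · by_cases h : r = s
    · simp [h]
    · rw [if_neg h, if_neg (by omega)]
  · by_cases h : r + s + 1 = t
    · rw [if_pos h, if_pos (by omega)]
    · rw [if_neg h, if_neg (by omega)]

/-- The matrix of `φ_t so_λ`. -/
noncomputable def phiMatrix (t n : ℕ) (lam : YoungDiagram) :
    Matrix (Fin (n * t)) (Fin (n * t)) SymFun :=
  Matrix.of fun i j => phiEntry t n (bead lam (n * t) i) (j : ℕ)

lemma phi_so_eq_det {t n : ℕ} {lam : YoungDiagram} (h : lam.colLen 0 ≤ n * t) :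
    phi t (so lam) = (phiMatrix t n lam).det := by
  rw [so_eq_det h, RingHom.map_det]
  congr 1
  ext1 i j
  simp [phiMatrix, phiEntry]

/-- A nonzero transversal matches beads with columns so that residues are preserved up to `r ↔ t - 1
- r`. Each pair of residues has `2n` columns; the middle residue, its own opposite, has `n` and is
counted separately. -/
lemma mr_add_mr_of_det_ne_zero {t n : ℕ} {lam : YoungDiagram}
    (h : (phiMatrix t n lam).det ≠ 0) {r : ℕ} (hr : r < t) :
    mr t lam (n * t) r + mr t lam (n * t) (t - 1 - r) = 2 * n := by
  have ht : 0 < t := by omega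
  obtain ⟨σ, hσ⟩ := exists_perm_of_det_ne_zero h
  have hmod : ∀ j : Fin (n * t), bead lam (n * t) (σ j) % t = j % t ∨
      bead lam (n * t) (σ j) % t = t - 1 - j % t := by
    intro j
    by_contra! hne
    apply hσ j
    have hj := Nat.mod_lt (j : ℕ) ht
    have e : ((j : ℕ) : ℤ) = ((j : ℕ) / t : ℕ) * (t : ℤ) + (t - 1 - ((t - 1 - j % t : ℕ) : ℤ)) := by
      have h1 : (((t - 1 - j % t : ℕ) : ℤ)) = t - 1 - (j % t : ℕ) := by omega
      rw [h1]
      have := Nat.div_add_mod' (j : ℕ) t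
      have : ((((j : ℕ) / t * t + j % t : ℕ)) : ℤ) = (j : ℕ) := by exact_mod_cast this
      push_cast at this ⊢
      linarith
    simp only [phiMatrix, Matrix.of_apply]
    rw [← Nat.div_add_mod' (bead lam (n * t) (σ j)) t, e,
      phiEntry_eq (Nat.mod_lt _ ht) (by omega), if_neg (by omega), if_neg (by omega), add_zero]
  have hcard : ∀ P : ℕ → Prop, ∀ [DecidablePred P],
      (∀ j : Fin (n * t), P (bead lam (n * t) (σ j) % t) ↔ P (j % t)) →
      (Finset.univ.filter fun i : Fin (n * t) => P (bead lam (n * t) i % t)).card =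
        (Finset.univ.filter fun j : Fin (n * t) => P (j % t)).card := by
    intro P _ hP
    refine (Finset.card_bij (fun j _ => σ j) ?_ (fun _ _ _ _ h => σ.injective h) ?_).symm
    · intro j hj
      simpa [hP] using hj
    · intro i hi
      refine ⟨σ.symm i, ?_, by simp⟩
      have := hP (σ.symm i)
      rw [Equiv.apply_symm_apply] at this
      simpa [← this] using hi
  by_cases hmid : r = t - 1 - r
  · have h1 := hcard (fun a => a = r) (fun j => by
      have := hmod j
      have := Nat.mod_lt (j : ℕ) ht
      omega)
    rw [← mr_eq_card, card_fin_mod_eq hr] at h1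
    rw [← hmid]
    omega
  · have h1 := hcard (fun a => a = r ∨ a = t - 1 - r) (fun j => by
      have := hmod j
      have := Nat.mod_lt (j : ℕ) ht
      omega)
    rw [Finset.filter_or, Finset.card_union_of_disjoint, Finset.filter_or,
      Finset.card_union_of_disjoint, ← mr_eq_card, ← mr_eq_card, card_fin_mod_eq hr,
      card_fin_mod_eq (by omega)] at h1
    · omega
    · exact Finset.disjoint_filter.2 fun j _ h1 h2 => by omega
    · exact Finset.disjoint_filter.2 fun j _ h1 h2 => by omega

/-! ### Products over runners -/

/-- The bound `2 ≤ t` matters: at `t = 1` the truncated `(t - 2) / 2` is `0`, and the middle runner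
would be counted twice. -/
lemma prod_range_split {R : Type*} [CommMonoid R] {t : ℕ} (ht : 2 ≤ t) (f : ℕ → R) :
    ∏ r ∈ Finset.range t, f r =
      (∏ r ∈ Finset.Icc 0 ((t - 2) / 2), f r) * (if Even t then 1 else f ((t - 1) / 2)) *
        ∏ r ∈ Finset.Icc ((t + 1) / 2) (t - 1), f r := by
  have hdisj : Disjoint (Finset.Icc 0 ((t - 1) / 2)) (Finset.Icc ((t + 1) / 2) (t - 1)) := by
    rw [Finset.disjoint_left]
    intro r hr hr'
    simp only [Finset.mem_Icc] at hr hr'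
    omega
  split_ifs with h
  · rw [Nat.even_iff] at h
    have h1 : Finset.range t = Finset.Icc 0 ((t - 1) / 2) ∪ Finset.Icc ((t + 1) / 2) (t - 1) := by
      ext r
      simp only [Finset.mem_range, Finset.mem_union, Finset.mem_Icc]
      omega
    have h2 : (t - 2) / 2 = (t - 1) / 2 := by omega
    rw [h1, Finset.prod_union hdisj, mul_one, h2]
  · rw [Nat.even_iff] at h
    have h1 : Finset.range t = Finset.Icc 0 ((t - 1) / 2) ∪ Finset.Icc ((t + 1) / 2) (t - 1) := by
      ext r
      simp only [Finset.mem_range, Finset.mem_union, Finset.mem_Icc]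
      omega
    have h2 : (t - 1) / 2 = (t - 2) / 2 + 1 := by omega
    rw [h1, Finset.prod_union hdisj, h2, ← Nat.range_succ_eq_Icc_zero, ← Nat.range_succ_eq_Icc_zero,
      Finset.prod_range_succ]

lemma prod_Icc_reflect {R : Type*} [CommMonoid R] {t : ℕ} (ht : 2 ≤ t) (f : ℕ → R) :
    ∏ r ∈ Finset.Icc 0 ((t - 2) / 2), f r =
      ∏ r ∈ Finset.Icc ((t + 1) / 2) (t - 1), f (t - 1 - r) := by
  refine Finset.prod_nbij' (fun r => t - 1 - r) (fun r => t - 1 - r) ?_ ?_ ?_ ?_ ?_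
  all_goals
    intro r hr
    simp only [Finset.mem_Icc] at hr ⊢
  · omega
  · omega
  · omega
  · omega
  · congr 1
    omega

lemma neg_one_pow_congr_mod {a b : ℕ} (h : a % 2 = b % 2) : (-1 : ℤ) ^ a = (-1) ^ b := by
  rw [neg_one_pow_eq_pow_mod_two, h, ← neg_one_pow_eq_pow_mod_two]

lemma sum_range_add_eq (a m : ℕ) : ∑ i ∈ Finset.range m, (a + i) = a * m + m.choose 2 := by
  rw [Finset.sum_add_distrib, Finset.sum_range_id, Nat.choose_two_right]
  simp [Nat.mul_comm]

/-! ### Three orderings of the beads of a balanced configuration -/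

/-- The column matched with the `i`-th largest of the `M` beads on the runner `r`. -/
def colNat (t n M r i : ℕ) : ℕ :=
  if M ≤ n + i then (n + i - M) * t + (t - 1 - r) else (M - 1 - i - n) * t + r

/-- The position of the `i`-th largest of the `M` beads on the runner `r`, when the pairs of
runners `r, t - 1 - r` are listed one after the other. -/
def pairNat (t n M r i : ℕ) : ℕ :=
  if 2 * r + 1 < t then r * (2 * n) + (2 * n - M + i)
  else if 2 * r + 1 = t then r * (2 * n) + i
  else (t - 1 - r) * (2 * n) + (M - 1 - i)

lemma colNat_lt {t n M r i : ℕ} (hr : r < t) (hi : i < M) (hM : M ≤ 2 * n) :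
    colNat t n M r i < n * t := by
  unfold colNat
  split_ifs
  · exact mul_add_lt (by omega) (by omega)
  · exact mul_add_lt (by omega) (by omega)

lemma pairNat_lt {t n M r i : ℕ} (hr : r < t) (hi : i < M) (hM : M ≤ 2 * n)
    (hmid : 2 * r + 1 = t → M = n) : pairNat t n M r i < n * t := by
  have key : ∀ q u, u < 2 * n → 2 * q + 2 ≤ t → q * (2 * n) + u < n * t := by
    intro q u hu hq
    calc q * (2 * n) + u < q * (2 * n) + 2 * n := by omega
      _ = n * (2 * q + 2) := by ring
      _ ≤ n * t := Nat.mul_le_mul_left _ hq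
  unfold pairNat
  split_ifs with h1 h2
  · exact key _ _ (by omega) (by omega)
  · have := hmid h2
    calc r * (2 * n) + i < r * (2 * n) + n := by omega
      _ = n * t := by rw [← h2]; ring
  · exact key _ _ (by omega) (by omega)

lemma colNat_inj {t n M M' r s i j : ℕ} (hr : r < t) (hs : s < t)
    (h1 : r = s → M = M') (h2 : r + s + 1 = t → M + M' = 2 * n)
    (h : colNat t n M r i = colNat t n M' s j) : r = s ∧ i = j := by
  unfold colNat at h
  split_ifs at h
  all_goals
    rw [mul_add_inj (by omega) (by omega)] at h
    omega

/-- The matched column is a function of the position in the pairwise listing, whatever the number of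
beads on each runner. Opposite runners fill complementary parts of the same `2n` positions, the
upper runner first and in reverse. -/
lemma colNat_eq_of_pairNat_eq {t n M M' r s i j : ℕ} (hr : r < t) (hs : s < t) (hi : i < M)
    (hj : j < M') (hM : M ≤ 2 * n) (hM' : M' ≤ 2 * n) (hmid : 2 * r + 1 = t → M = n)
    (hmid' : 2 * s + 1 = t → M' = n) (h : pairNat t n M r i = pairNat t n M' s j) :
    colNat t n M r i = colNat t n M' s j := by
  unfold pairNat at h
  split_ifs at h
  all_goals
    rw [mul_add_inj (by omega) (by omega)] at h
    obtain ⟨h1, h2⟩ := h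
    unfold colNat
    split_ifs
  all_goals
    rw [mul_add_inj (by omega) (by omega)]
    omega

lemma le_of_mul_add_lt {a q q' u u' : ℕ} (hu' : u' < a) (h : q * a + u < q' * a + u') :
    q < q' ∨ q = q' ∧ u < u' := by
  rcases lt_trichotomy q q' with h1 | h1 | h1
  · exact Or.inl h1
  · subst h1; exact Or.inr ⟨rfl, by omega⟩
  · have : (q' + 1) * a ≤ q * a := Nat.mul_le_mul_right _ h1
    rw [Nat.add_mul] at this
    omega

/-- Whether two beads are discordant depends only on the one that comes first in the pairwise
listing. A bead on an upper runner disagrees with everything after it, any other bead with nothing.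
-/
lemma lex_of_pairNat_lt {t n M M' r s i j : ℕ} (hr : r < t) (hs : s < t) (hi : i < M)
    (hj : j < M') (hM' : M' ≤ 2 * n) (h1 : r = s → M = M')
    (hmid' : 2 * s + 1 = t → M' = n) (h : pairNat t n M r i < pairNat t n M' s j) :
    (r < s ∨ r = s ∧ i < j) ↔ ¬ t < 2 * r + 1 := by
  unfold pairNat at h
  split_ifs at h
  all_goals
    have := le_of_mul_add_lt (by omega) h
    omega

section Balanced

variable (t n : ℕ) (m : ℕ → ℕ)

/-- `m r` beads on each runner `r < t`, such that opposite runners have `2 n` beads in total. -/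
def Balanced : Prop := ∀ r < t, m r + m (t - 1 - r) = 2 * n

/-- Labels for the beads: the runner, and the position on the runner, from large to small. -/
abbrev BeadIndex : Type := Σ r : Fin t, Fin (m r)

variable {t n m}

lemma Balanced.le (h : Balanced t n m) (r : Fin t) : m r ≤ 2 * n := by
  have := h r r.isLt
  omega

lemma Balanced.mid (h : Balanced t n m) (r : Fin t) (hr : 2 * (r : ℕ) + 1 = t) : m r = n := by
  have h1 := h r r.isLt
  have h2 : t - 1 - (r : ℕ) = r := by omega
  rw [h2] at h1
  omega

lemma Balanced.sum (h : Balanced t n m) : ∑ r ∈ Finset.range t, m r = n * t := by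
  have h1 := Finset.sum_range_reflect m t
  have h2 : ∑ r ∈ Finset.range t, (m r + m (t - 1 - r)) = t * (2 * n) := by
    rw [Finset.sum_congr rfl fun r hr => h r (Finset.mem_range.1 hr)]
    simp
  rw [Finset.sum_add_distrib, h1] at h2
  nlinarith

lemma BeadIndex.ext {x y : BeadIndex t m} (h1 : (x.1 : ℕ) = y.1) (h2 : (x.2 : ℕ) = y.2) :
    x = y := by
  obtain ⟨r, i⟩ := x
  obtain ⟨s, j⟩ := y
  obtain rfl : r = s := Fin.ext h1
  obtain rfl : i = j := Fin.ext h2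
  rfl

lemma Balanced.card (h : Balanced t n m) : Fintype.card (BeadIndex t m) = n * t := by
  rw [Fintype.card_sigma, ← h.sum]
  simp only [Fintype.card_fin]
  exact Fin.sum_univ_eq_sum_range m t

lemma Balanced.colNat_injective (h : Balanced t n m) {x y : BeadIndex t m}
    (hxy : colNat t n (m x.1) x.1 x.2 = colNat t n (m y.1) y.1 y.2) : x = y := by
  have := colNat_inj x.1.isLt y.1.isLt (fun h => by rw [h]) (fun h' => by
    have h1 := h x.1 x.1.isLt
    rwa [show t - 1 - (x.1 : ℕ) = y.1 by omega] at h1) hxy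
  exact BeadIndex.ext this.1 this.2

/-- The matching of beads and columns. -/
noncomputable def Balanced.colEquiv (h : Balanced t n m) : BeadIndex t m ≃ Fin (n * t) :=
  Equiv.ofBijective
    (fun x => ⟨colNat t n (m x.1) x.1 x.2, colNat_lt x.1.isLt x.2.isLt (h.le x.1)⟩) (by
      rw [Fintype.bijective_iff_injective_and_card]
      exact ⟨fun x y hxy => h.colNat_injective (congrArg Fin.val hxy), by rw [h.card]; simp⟩)

/-- The ordering of the beads by pairs of opposite runners. -/
noncomputable def Balanced.pairEquiv (h : Balanced t n m) : BeadIndex t m ≃ Fin (n * t) :=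
  Equiv.ofBijective
    (fun x => ⟨pairNat t n (m x.1) x.1 x.2,
      pairNat_lt x.1.isLt x.2.isLt (h.le x.1) (h.mid x.1)⟩) (by
      rw [Fintype.bijective_iff_injective_and_card]
      refine ⟨fun x y hxy => h.colNat_injective ?_, by rw [h.card]; simp⟩
      exact colNat_eq_of_pairNat_eq x.1.isLt y.1.isLt x.2.isLt y.2.isLt (h.le x.1) (h.le y.1)
        (h.mid x.1) (h.mid y.1) (congrArg Fin.val hxy))

lemma Balanced.colEquiv_val (h : Balanced t n m) (x : BeadIndex t m) :
    (h.colEquiv x : ℕ) = colNat t n (m x.1) x.1 x.2 := rfl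

lemma Balanced.pairEquiv_val (h : Balanced t n m) (x : BeadIndex t m) :
    (h.pairEquiv x : ℕ) = pairNat t n (m x.1) x.1 x.2 := rfl

/-- The ordering of the beads by runners. -/
def lexKey (x : BeadIndex t m) : ℕ ×ₗ ℕ := toLex ((x.1 : ℕ), (x.2 : ℕ))

lemma lexKey_lt {x y : BeadIndex t m} :
    lexKey x < lexKey y ↔ (x.1 : ℕ) < y.1 ∨ (x.1 : ℕ) = y.1 ∧ (x.2 : ℕ) < y.2 :=
  Prod.Lex.toLex_lt_toLex

lemma lexKey_injective : Function.Injective (lexKey : BeadIndex t m → ℕ ×ₗ ℕ) := by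
  intro x y hxy
  have := toLex.injective hxy
  exact BeadIndex.ext (congrArg Prod.fst this) (congrArg Prod.snd this)

lemma Balanced.orderSign_lex_pair (ht : 2 ≤ t) (h : Balanced t n m) :
    orderSign lexKey lexKey h.pairEquiv =
      ∏ r ∈ Finset.Icc ((t + 1) / 2) (t - 1), (-1) ^ ((m r + 1).choose 2 + n * t * m r) := by
  have h1 : ∀ x : BeadIndex t m, (∏ y, if h.pairEquiv x < h.pairEquiv y then
      (if (lexKey x < lexKey y ↔ h.pairEquiv x < h.pairEquiv y) then (1 : ℤ) else -1) else 1) =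
      if t < 2 * (x.1 : ℕ) + 1 then (-1) ^ (n * t + m x.1 + x.2) else 1 := by
    intro x
    have e : ∀ y, (if h.pairEquiv x < h.pairEquiv y then
        (if (lexKey x < lexKey y ↔ h.pairEquiv x < h.pairEquiv y) then (1 : ℤ) else -1) else 1) =
        if h.pairEquiv x < h.pairEquiv y then (if t < 2 * (x.1 : ℕ) + 1 then -1 else 1) else 1 := by
      intro y
      by_cases hlt : h.pairEquiv x < h.pairEquiv y
      · have := lex_of_pairNat_lt x.1.isLt y.1.isLt x.2.isLt y.2.isLt (h.le y.1)
          (fun h => by rw [h]) (h.mid y.1) (Fin.lt_def.1 hlt)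
        simp only [hlt, if_true, iff_true, lexKey_lt, this, ite_not]
      · simp [hlt]
    simp only [e]
    rw [h.pairEquiv.prod_comp (fun v => if h.pairEquiv x < v then _ else (1 : ℤ))]
    split_ifs with hx
    -- The exponent is the number of beads listed later, `nt - 1 - pairNat`. Modulo `2` the multiple
    -- of `2n` in `pairNat` drops out.
    · rw [← Finset.prod_filter, Finset.prod_const, Finset.filter_lt_eq_Ioi, Fin.card_Ioi]
      apply neg_one_pow_congr_mod
      have hlt := (h.pairEquiv x).isLt
      rw [h.pairEquiv_val] at hlt ⊢
      have h2 := x.2.isLt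
      have e2 : ∀ q, q * (2 * n) = 2 * (q * n) := fun q => by ring
      rw [pairNat, if_neg (by omega), if_neg (by omega), e2] at hlt ⊢
      generalize (t - 1 - (x.1 : ℕ)) * n = p at *
      omega
    · simp
  rw [orderSign_key (k' := h.pairEquiv) lexKey_injective h.pairEquiv.injective lexKey_injective
    h.pairEquiv.injective, orderSign, Finset.prod_congr rfl fun x _ => h1 x, Fintype.prod_sigma]
  simp only
  have h2 : ∀ r : ℕ, (∏ i : Fin (m r), if t < 2 * r + 1 then
      (-1 : ℤ) ^ (n * t + m r + (i : ℕ)) else 1) =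
      if t < 2 * r + 1 then (-1) ^ ((m r + 1).choose 2 + n * t * m r) else 1 := by
    intro r
    split_ifs
    · rw [Fin.prod_univ_eq_prod_range (fun i => (-1 : ℤ) ^ (n * t + m r + i)),
        Finset.prod_pow_eq_pow_sum, sum_range_add_eq, Nat.choose_succ_succ' (m r) 1,
        Nat.choose_one_right]
      apply neg_one_pow_congr_mod
      have : m r * m r % 2 = m r % 2 := by
        rcases Nat.mod_two_eq_zero_or_one (m r) with h | h <;> simp [Nat.mul_mod, h]
      rw [Nat.add_mul]
      simp only [Nat.reduceAdd]
      omega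
    · simp
  rw [Finset.prod_congr rfl fun r _ => h2 (r : Fin t),
    Fin.prod_univ_eq_prod_range (fun r => if t < 2 * r + 1 then
      (-1 : ℤ) ^ ((m r + 1).choose 2 + n * t * m r) else 1), ← Finset.prod_filter]
  refine Finset.prod_congr ?_ fun _ _ => rfl
  ext r
  simp only [Finset.mem_filter, Finset.mem_range, Finset.mem_Icc]
  omega

/-- Both sides are the sign of one permutation from positions to columns, by
`colNat_eq_of_pairNat_eq`. It may thus be evaluated at the constant configuration `m r = n`. -/
lemma Balanced.orderSign_pair_col {m' : ℕ → ℕ} (h : Balanced t n m) (h' : Balanced t n m') :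
    orderSign lexKey h.pairEquiv h.colEquiv = orderSign lexKey h'.pairEquiv h'.colEquiv := by
  have e : h.colEquiv = h'.colEquiv ∘ (h.pairEquiv.trans h'.pairEquiv.symm) := by
    funext x
    apply Fin.ext
    set y := (h.pairEquiv.trans h'.pairEquiv.symm) x with hy
    have hxy : h'.pairEquiv y = h.pairEquiv x := by simp [hy]
    have hxy := congrArg Fin.val hxy
    simp only [Function.comp, h.colEquiv_val, h'.colEquiv_val, h.pairEquiv_val,
      h'.pairEquiv_val] at hxy ⊢
    exact colNat_eq_of_pairNat_eq x.1.isLt y.1.isLt x.2.isLt y.2.isLt (h.le x.1) (h'.le y.1)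
        (h.mid x.1) (h'.mid y.1) hxy.symm
  have e' : h.pairEquiv = h'.pairEquiv ∘ (h.pairEquiv.trans h'.pairEquiv.symm) := by
    funext x; simp
  rw [orderSign_key (k' := lexKey ∘ (h.pairEquiv.trans h'.pairEquiv.symm)) lexKey_injective
    (lexKey_injective.comp (Equiv.injective _)) h.pairEquiv.injective h.colEquiv.injective,
    e, e', orderSign_comp]

lemma balanced_const : Balanced t n fun _ => n := fun _ _ => by ring

/-- Here bead `(r, i)` has column `i * t + (t - 1 - r)`. For runners `r < s` the beads `(r, i)`,
`(s, j)` are discordant iff `j ≤ i`, giving `binom(n+1, 2)` discordances for each of the `binom(t,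
2)` pairs of runners. -/
lemma orderSign_lex_col_const :
    orderSign lexKey lexKey (balanced_const (t := t) (n := n)).colEquiv =
      (-1) ^ ((n + 1).choose 2 * t.choose 2) := by
  set h := balanced_const (t := t) (n := n)
  have hval : ∀ x : BeadIndex t fun _ => n,
      (h.colEquiv x : ℕ) = x.2 * t + (t - 1 - (x.1 : ℕ)) := by
    intro x
    rw [h.colEquiv_val, colNat, if_pos (by omega), Nat.add_sub_cancel_left]
  simp only [orderSign, Fintype.prod_sigma]
  have e1 : ∀ r s : Fin t, ∀ i j : Fin n,
      (if (lexKey (t := t) (m := fun _ => n) ⟨r, i⟩ < lexKey (t := t) (m := fun _ => n) ⟨s, j⟩) then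
        (if (lexKey (t := t) (m := fun _ => n) ⟨r, i⟩ < lexKey (t := t) (m := fun _ => n) ⟨s, j⟩ ↔
          h.colEquiv ⟨r, i⟩ < h.colEquiv ⟨s, j⟩) then (1 : ℤ) else -1) else 1) =
      if r < s then (if i < j then 1 else -1) else 1 := by
    intro r s i j
    have hcmp : ∀ {a b c d : ℕ}, b < t → d < t →
        (a * t + b < c * t + d ↔ a < c ∨ a = c ∧ b < d) := by
      intro a b c d hb hd
      refine ⟨le_of_mul_add_lt hd, ?_⟩
      rintro (hac | ⟨rfl, hbd⟩)
      · have := mul_add_lt hb hac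
        omega
      · omega
    have hcol : h.colEquiv ⟨r, i⟩ < h.colEquiv ⟨s, j⟩ ↔
        (i : ℕ) < j ∨ (i : ℕ) = j ∧ t - 1 - (r : ℕ) < t - 1 - s := by
      rw [Fin.lt_def, hval, hval]
      exact hcmp (by omega) (by omega)
    by_cases hrs : r < s
    · have hrs' := Fin.lt_def.1 hrs
      have h1 : lexKey (t := t) (m := fun _ => n) ⟨r, i⟩ < lexKey (t := t) (m := fun _ => n) ⟨s, j⟩ :=
        lexKey_lt.2 (Or.inl hrs')
      have h2 : h.colEquiv ⟨r, i⟩ < h.colEquiv ⟨s, j⟩ ↔ i < j := by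
        rw [hcol, Fin.lt_def]
        omega
      simp only [h1, h2, hrs, if_true, true_iff]
    · rw [if_neg hrs]
      have hrs' := fun h => hrs (Fin.lt_def.2 h)
      split_ifs with h1 h2
      · rfl
      · refine absurd (iff_of_true h1 ?_) h2
        rw [lexKey_lt] at h1
        simp only at h1
        rw [hcol]
        omega
      · rfl
  simp only [e1]
  have e2 : ∀ i : Fin n, (∏ j : Fin n, if i < j then (1 : ℤ) else -1) = (-1) ^ (1 + (i : ℕ)) := by
    intro i
    have : ∀ j : Fin n, (if i < j then (1 : ℤ) else -1) = if j ≤ i then -1 else 1 := by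
      intro j
      by_cases hj : i < j
      · rw [if_pos hj, if_neg (not_le.2 hj)]
      · rw [if_neg hj, if_pos (not_lt.1 hj)]
    simp only [this]
    rw [← Finset.prod_filter, Finset.prod_const, Finset.filter_ge_eq_Iic, Fin.card_Iic, add_comm]
  have e3 : (∏ i : Fin n, ∏ j : Fin n, if i < j then (1 : ℤ) else -1) =
      (-1) ^ (n + 1).choose 2 := by
    simp only [e2]
    rw [Fin.prod_univ_eq_prod_range (fun i => (-1 : ℤ) ^ (1 + i)), Finset.prod_pow_eq_pow_sum,
      sum_range_add_eq, Nat.choose_succ_succ' n 1, Nat.choose_one_right, one_mul]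
  have e4 : ∀ r : Fin t, (∏ i : Fin n, ∏ s : Fin t, ∏ j : Fin n,
      if r < s then (if i < j then (1 : ℤ) else -1) else 1) =
      ((-1) ^ (n + 1).choose 2) ^ (t - 1 - (r : ℕ)) := by
    intro r
    rw [Finset.prod_comm]
    have : ∀ s : Fin t, (∏ i : Fin n, ∏ j : Fin n,
        if r < s then (if i < j then (1 : ℤ) else -1) else 1) =
        if r < s then (-1) ^ (n + 1).choose 2 else 1 := by
      intro s
      by_cases hrs : r < s <;> simp [hrs, e3]
    simp only [this]
    rw [← Finset.prod_filter, Finset.prod_const, Finset.filter_lt_eq_Ioi, Fin.card_Ioi]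
  simp only [e4]
  rw [Fin.prod_univ_eq_prod_range (fun r => ((-1 : ℤ) ^ (n + 1).choose 2) ^ (t - 1 - r)),
    Finset.prod_range_reflect, Finset.prod_pow_eq_pow_sum, Finset.sum_range_id,
    ← Nat.choose_two_right, pow_mul]

lemma Balanced.orderSign_lex_col (ht : 2 ≤ t) (h : Balanced t n m) :
    orderSign lexKey lexKey h.colEquiv =
      ∏ r ∈ Finset.Icc ((t + 1) / 2) (t - 1),
        (-1) ^ ((m r + 1).choose 2 + n * t * (m r + 1)) := by
  rw [← orderSign_mul _ _ h.pairEquiv, h.orderSign_lex_pair ht,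
    h.orderSign_pair_col balanced_const,
    ← orderSign_mul lexKey (balanced_const (t := t) (n := n)).pairEquiv lexKey,
    orderSign_comm, balanced_const.orderSign_lex_pair ht, orderSign_lex_col_const]
  have hcard : (Finset.Icc ((t + 1) / 2) (t - 1)).card = t / 2 := by
    rw [Nat.card_Icc]; omega
  -- `binom(t, 2)` has the parity of `t / 2`, the number of upper runners. The constant sign can so
  -- be spread over the upper runners, where it cancels the `binom(n+1, 2)` coming from the constant
  -- configuration.
  have hchoose : t.choose 2 % 2 = t / 2 % 2 := by
    rw [Nat.choose_two_right]
    rcases Nat.even_or_odd' t with ⟨k, rfl | rfl⟩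
    · rw [Nat.mul_assoc, Nat.mul_div_cancel_left _ two_pos, Nat.mul_div_cancel_left _ two_pos]
      rw [Nat.mul_mod, show (2 * k - 1) % 2 = 1 by omega]
      simp
    · rw [Nat.add_sub_cancel, show (2 * k + 1) * (2 * k) = 2 * ((2 * k + 1) * k) by ring,
        Nat.mul_div_cancel_left _ two_pos, Nat.mul_mod, show (2 * k + 1) % 2 = 1 by omega]
      rw [show (2 * k + 1) / 2 = k by omega]
      simp
  have hc : (-1 : ℤ) ^ ((n + 1).choose 2 * t.choose 2) =
      ∏ r ∈ Finset.Icc ((t + 1) / 2) (t - 1), (-1) ^ (n + 1).choose 2 := by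
    rw [Finset.prod_const, hcard, ← pow_mul]
    apply neg_one_pow_congr_mod
    rw [Nat.mul_mod, hchoose, ← Nat.mul_mod]
  rw [hc, ← Finset.prod_mul_distrib, ← Finset.prod_mul_distrib]
  refine Finset.prod_congr rfl fun r _ => ?_
  rw [← pow_add, ← pow_add]
  apply neg_one_pow_congr_mod
  have e1 : n * t * n % 2 = n * t % 2 := by
    rcases Nat.mod_two_eq_zero_or_one n with h | h <;> simp [Nat.mul_mod, h]
  rw [Nat.mul_add]
  omega

end Balanced

/-! ### The exponent `ε^so` -/

/-- The rank of the core is the total excess of the runners over `n`. By balance, each pair of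
opposite runners contributes `|m_r - n| ≡ m_r + n`; for odd `t`, multiplying by `n` gives `n(m_r +
n) ≡ nt(m_r + 1)` modulo `2`. For even `t` the extra terms are even. -/
lemma neg_one_pow_epsSo {t n : ℕ} {lam : YoungDiagram} (ht : 2 ≤ t)
    (h : Balanced t n (mr t lam (n * t))) :
    (-1 : ℤ) ^ epsSo t n lam = ∏ r ∈ Finset.Icc ((t + 1) / 2) (t - 1),
      (-1) ^ ((mr t lam (n * t) r + 1).choose 2 + n * t * (mr t lam (n * t) r + 1)) := by
  have hrk : (-1 : ℤ) ^ rk (core t lam (n * t)) =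
      ∏ r ∈ Finset.Icc ((t + 1) / 2) (t - 1), (-1) ^ (mr t lam (n * t) r + n) := by
    rw [rk_core (by omega), ← Finset.prod_pow_eq_pow_sum, prod_range_split ht, prod_Icc_reflect ht]
    have hmid : (if Even t then (1 : ℤ) else
        (-1) ^ (mr t lam (n * t) ((t - 1) / 2) - n)) = 1 := by
      split_ifs with he
      · rfl
      · rw [Nat.even_iff] at he
        rw [h.mid ⟨(t - 1) / 2, by omega⟩ (by simp only; omega)]
        simp
    rw [hmid, mul_one, ← Finset.prod_mul_distrib]
    refine Finset.prod_congr rfl fun r hr => ?_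
    rw [Finset.mem_Icc] at hr
    have := h r (by omega)
    rw [← pow_add]
    apply neg_one_pow_congr_mod
    omega
  rw [epsSo, pow_add, ← Finset.prod_pow_eq_pow_sum]
  simp only [pow_add (-1 : ℤ) (Nat.choose _ _)]
  rw [Finset.prod_mul_distrib]
  congr 1
  split_ifs with he
  · rw [pow_zero, Finset.prod_eq_one]
    intro r _
    exact Even.neg_one_pow (he.mul_left n |>.mul_right _)
  · rw [mul_comm, pow_mul, hrk, ← Finset.prod_pow]
    refine Finset.prod_congr rfl fun r _ => ?_
    rw [← pow_mul]
    apply neg_one_pow_congr_mod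
    rw [Nat.even_iff] at he
    rw [Nat.mul_mod, Nat.mul_mod (n * t), Nat.mul_mod n t, Nat.add_mod, Nat.add_mod _ 1]
    have h1 : t % 2 = 1 := by omega
    rw [h1]
    rcases Nat.mod_two_eq_zero_or_one n with h2 | h2 <;>
      rcases Nat.mod_two_eq_zero_or_one (mr t lam (n * t) r) with h3 | h3 <;> simp [h2, h3]

/-! ### Labelling the beads by runner and position -/

section Rows

variable {t n : ℕ} {lam : YoungDiagram}

/-- The `i`-th largest of the numbers `ξ` with `ξ t + r` a bead, where `x = (r, i)`. -/
def runnerBead (lam : YoungDiagram) {t n : ℕ} (x : BeadIndex t (mr t lam (n * t))) : ℕ :=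
  bead (quot t lam (n * t) x.1) (mr t lam (n * t) x.1) x.2

lemma exists_bead_eq (x : BeadIndex t (mr t lam (n * t))) :
    ∃ i, bead lam (n * t) i = runnerBead lam x * t + x.1 :=
  mem_beta.1 ((mem_beta_quot x.1.isLt lam (n * t) _).1 (mem_beta.2 ⟨x.2, rfl⟩))

lemma Balanced.rowEquiv_aux (h : Balanced t n (mr t lam (n * t))) :
    Function.Bijective fun x : BeadIndex t (mr t lam (n * t)) => (exists_bead_eq x).choose := by
  rw [Fintype.bijective_iff_injective_and_card]
  refine ⟨fun x y hxy => ?_, by rw [h.card]; simp⟩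
  have h1 := (exists_bead_eq x).choose_spec
  have h2 := (exists_bead_eq y).choose_spec
  simp only at hxy
  rw [hxy, h2, mul_add_inj y.1.isLt x.1.isLt] at h1
  obtain ⟨h3, h4⟩ := h1
  obtain ⟨r, i⟩ := x
  obtain ⟨s, j⟩ := y
  obtain rfl : s = r := Fin.ext h4
  have hij : j = i := (bead_strictAnti _ _).injective h3
  rw [hij]

/-- The row of the determinant belonging to a bead. -/
noncomputable def Balanced.rowEquiv (h : Balanced t n (mr t lam (n * t))) :
    BeadIndex t (mr t lam (n * t)) ≃ Fin (n * t) :=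
  Equiv.ofBijective _ h.rowEquiv_aux

lemma Balanced.bead_rowEquiv (h : Balanced t n (mr t lam (n * t)))
    (x : BeadIndex t (mr t lam (n * t))) :
    bead lam (n * t) (h.rowEquiv x) = runnerBead lam x * t + x.1 :=
  (exists_bead_eq x).choose_spec

lemma wPerm_symm_lt_iff {N : ℕ} {i j : Fin N} :
    (wPerm t lam N).symm i < (wPerm t lam N).symm j ↔
      bead lam N i % t < bead lam N j % t ∨ bead lam N i % t = bead lam N j % t ∧ i < j := by
  obtain ⟨hmono, hstable⟩ := Tuple.eq_sort_iff.1 (rfl : wPerm t lam N = _)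
  have key : ∀ u v, u < v → bead lam N (wPerm t lam N u) % t < bead lam N (wPerm t lam N v) % t ∨
      bead lam N (wPerm t lam N u) % t = bead lam N (wPerm t lam N v) % t ∧
        wPerm t lam N u < wPerm t lam N v := by
    intro u v huv
    rcases (hmono huv.le).lt_or_eq with h | h
    · exact Or.inl h
    · exact Or.inr ⟨h, hstable u v huv h⟩
  obtain ⟨u, rfl⟩ := (wPerm t lam N).surjective i
  obtain ⟨v, rfl⟩ := (wPerm t lam N).surjective j
  simp only [Equiv.symm_apply_apply]
  refine ⟨key u v, fun h => ?_⟩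
  by_contra! hvu
  rcases hvu.lt_or_eq with h1 | rfl
  · rcases key v u h1 with h2 | ⟨h2, h3⟩ <;> rcases h with h4 | ⟨h4, h5⟩
    · omega
    · omega
    · omega
    · exact lt_asymm h3 h5
  · simp at h

lemma Balanced.sign_wPerm (h : Balanced t n (mr t lam (n * t))) :
    ((Equiv.Perm.sign (wPerm t lam (n * t)) : ℤˣ) : ℤ) =
      orderSign lexKey h.rowEquiv lexKey := by
  have hlt : ∀ x y, (wPerm t lam (n * t)).symm (h.rowEquiv x) <
      (wPerm t lam (n * t)).symm (h.rowEquiv y) ↔ lexKey x < lexKey y := by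
    intro x y
    rw [wPerm_symm_lt_iff, lexKey_lt, h.bead_rowEquiv, h.bead_rowEquiv,
      mul_add_mod_self x.1.isLt, mul_add_mod_self y.1.isLt]
    refine or_congr_right (and_congr_right fun hxy => ?_)
    obtain ⟨r, i⟩ := x
    obtain ⟨s, j⟩ := y
    obtain rfl : r = s := Fin.ext hxy
    have ht : 0 < t := by have := r.isLt; omega
    rw [← bead_lt_iff lam, h.bead_rowEquiv, h.bead_rowEquiv, Nat.add_lt_add_iff_right, Nat.mul_lt_mul_right ht]
    exact bead_lt_iff _ _
  -- `wPerm` sends sorted positions to labels, so it is the inverse that compares labels by runner;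
  -- passing to it leaves the sign unchanged.
  rw [← Equiv.Perm.sign_symm, sign_eq_orderSign, ← orderSign_comp h.rowEquiv,
    orderSign_congr _ (f' := h.rowEquiv) (g' := lexKey) (by simp) (by simpa using hlt)]
  exact orderSign_key (by simpa using h.rowEquiv.injective) lexKey_injective
    h.rowEquiv.injective lexKey_injective

/-! ### The block decomposition -/

/-- The second branch of `colNat` is the reflection of the first at a negative quotient `n + j - M`.
By `phiEntry_neg` both branches have the same entry formula. -/
lemma phiEntry_colNat {M r s : ℕ} (hr : r < t) (hs : s < t) (b j : ℕ) :
    phiEntry t n (b * t + r) (colNat t n M s j : ℕ) =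
      (if r = s then hInt ((b : ℤ) + 1 + j - M) else 0) +
        if r + s + 1 = t then hInt ((b : ℤ) - 2 * n - j + M) else 0 := by
  have h1 := phiEntry_eq hr hs n b ((n : ℤ) + j - M)
  have h2 : phiEntry t n (b * t + r) (colNat t n M s j : ℕ) =
      phiEntry t n (b * t + r) (((n : ℤ) + j - M) * t + (t - 1 - s)) := by
    rw [colNat]
    split_ifs with hM
    · congr 1
      push_cast [Nat.cast_sub hM, Nat.cast_sub (show s ≤ t - 1 by omega),
        Nat.cast_sub (show 1 ≤ t by omega)]
      ring
    · rw [← phiEntry_neg]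
      congr 1
      rw [show M - 1 - j - n = M - (1 + j + n) by omega]
      push_cast [Nat.cast_sub (show 1 + j + n ≤ M by omega)]
      ring
  rw [h2, h1]
  congr 3 <;> ring

/-- The matrix of `φ_t so_λ`, with rows and columns labelled by the beads. -/
noncomputable def Balanced.blockMatrix (h : Balanced t n (mr t lam (n * t))) :
    Matrix (BeadIndex t (mr t lam (n * t))) (BeadIndex t (mr t lam (n * t))) SymFun :=
  (phiMatrix t n lam).submatrix h.rowEquiv h.colEquiv

lemma Balanced.blockMatrix_apply (h : Balanced t n (mr t lam (n * t)))
    (x y : BeadIndex t (mr t lam (n * t))) :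
    h.blockMatrix x y =
      (if (x.1 : ℕ) = y.1 then hInt ((runnerBead lam x : ℤ) + 1 + y.2 - mr t lam (n * t) y.1)
        else 0) +
      if (x.1 : ℕ) + y.1 + 1 = t then
        hInt ((runnerBead lam x : ℤ) - 2 * n - y.2 + mr t lam (n * t) y.1) else 0 := by
  rw [← phiEntry_colNat x.1.isLt y.1.isLt _ _, blockMatrix, Matrix.submatrix_apply,
    phiMatrix, Matrix.of_apply, h.bead_rowEquiv, h.colEquiv_val]

/-- The smaller one of a runner and its opposite. -/
def pairClass {m : ℕ → ℕ} (x : BeadIndex t m) : Fin t :=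
  ⟨min x.1 (t - 1 - x.1), (min_le_left _ _).trans_lt x.1.isLt⟩

lemma pairClass_eq_iff {m : ℕ → ℕ} {x : BeadIndex t m} {k : Fin t} :
    pairClass x = k ↔ 2 * (k : ℕ) + 1 ≤ t ∧ ((x.1 : ℕ) = k ∨ (x.1 : ℕ) + k + 1 = t) := by
  have := x.1.isLt
  rw [pairClass, Fin.ext_iff]
  simp only
  omega

lemma Balanced.blockTriangular (h : Balanced t n (mr t lam (n * t))) :
    h.blockMatrix.BlockTriangular pairClass := by
  intro x y hxy
  have hlt := Fin.lt_def.1 hxy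
  have h1 := x.1.isLt
  have h2 := y.1.isLt
  simp only [pairClass] at hlt
  rw [h.blockMatrix_apply, if_neg (by omega), if_neg (by omega), add_zero]

lemma Balanced.det_block_of_lt (h : Balanced t n (mr t lam (n * t))) {k : ℕ}
    (hk : 2 * k + 1 < t) :
    (h.blockMatrix.toSquareBlock pairClass ⟨k, by omega⟩).det =
      rs (quot t lam (n * t) k) (quot t lam (n * t) (t - 1 - k)) := by
  have hk' : k < t := by omega
  have hbal := h k hk'
  rw [rs_eq_det (colLen_quot t lam (n * t) k) (colLen_quot t lam (n * t) (t - 1 - k))]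
  set f : Fin (mr t lam (n * t) k) ⊕ Fin (mr t lam (n * t) (t - 1 - k)) →
      {x : BeadIndex t (mr t lam (n * t)) // pairClass x = ⟨k, hk'⟩} :=
    Sum.elim (fun i => ⟨⟨⟨k, hk'⟩, i⟩, pairClass_eq_iff.2 ⟨hk.le, Or.inl rfl⟩⟩)
      (fun i => ⟨⟨⟨t - 1 - k, by omega⟩, i⟩,
        pairClass_eq_iff.2 ⟨hk.le, Or.inr (by simp only; omega)⟩⟩) with hf
  have hbij : Function.Bijective f := by
    constructor
    · have hval : ∀ x y, f x = f y →
          (((f x).1.1 : ℕ) = (f y).1.1) ∧ ((f x).1.2 : ℕ) = (f y).1.2 := by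
        intro x y hxy
        rw [hxy]
        exact ⟨rfl, rfl⟩
      rintro (i | i) (j | j) hxy <;> obtain ⟨h1, h2⟩ := hval _ _ hxy <;>
        simp only [hf, Sum.elim_inl, Sum.elim_inr] at h1 h2
      · exact congrArg Sum.inl (Fin.ext h2)
      · omega
      · omega
      · exact congrArg Sum.inr (Fin.ext h2)
    · rintro ⟨⟨⟨r, hr⟩, i⟩, hx⟩
      rcases (pairClass_eq_iff.1 hx).2 with h1 | h1
      · simp only at h1
        subst h1
        exact ⟨Sum.inl i, rfl⟩
      · simp only at h1
        obtain rfl : r = t - 1 - k := by omega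
        exact ⟨Sum.inr i, rfl⟩
  rw [← Matrix.det_submatrix_equiv_self (Equiv.ofBijective f hbij)]
  congr 1
  -- On equal runners the first summand of the entry survives, on opposite runners the second.
  -- Balance, `m_k + m_{t-1-k} = 2n`, turns the indices of the latter into those of `rsAux`.
  ext1 (i | i) (j | j) <;>
    simp only [Matrix.submatrix_apply, Equiv.ofBijective_apply, hf, Sum.elim_inl, Sum.elim_inr,
      Matrix.toSquareBlock_def, Matrix.of_apply, h.blockMatrix_apply, rsAux, boundaryFun,
      colLen_bot, bead, rowLen_bot, runnerBead]
  · rw [if_true, if_neg (by omega), add_zero]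
    congr 1
    omega
  · rw [if_neg (by omega), if_pos (by omega), zero_add]
    congr 1
    omega
  · rw [if_neg (by omega), if_pos (by omega), zero_add]
    congr 1
    omega
  · rw [if_true, if_neg (by omega), add_zero]
    congr 1
    omega

lemma Balanced.det_block_of_eq (h : Balanced t n (mr t lam (n * t))) {k : ℕ}
    (hk : 2 * k + 1 = t) :
    (h.blockMatrix.toSquareBlock pairClass ⟨k, by omega⟩).det = so (quot t lam (n * t) k) := by
  have hk' : k < t := by omega
  have hm : mr t lam (n * t) k = n := h.mid ⟨k, hk'⟩ hk
  rw [so_eq_det (colLen_quot t lam (n * t) k)]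
  set f : Fin (mr t lam (n * t) k) →
      {x : BeadIndex t (mr t lam (n * t)) // pairClass x = ⟨k, hk'⟩} :=
    fun i => ⟨⟨⟨k, hk'⟩, i⟩, pairClass_eq_iff.2 ⟨hk.le, Or.inl rfl⟩⟩ with hf
  have hbij : Function.Bijective f := by
    constructor
    · intro i j hij
      have : ((f i).1.2 : ℕ) = (f j).1.2 := by rw [hij]
      exact Fin.ext this
    · rintro ⟨⟨⟨r, hr⟩, i⟩, hx⟩
      have h1 := (pairClass_eq_iff.1 hx).2
      simp only at h1
      obtain rfl : r = k := by omega
      exact ⟨i, rfl⟩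
  rw [← Matrix.det_submatrix_equiv_self (Equiv.ofBijective f hbij)]
  congr 1
  ext1 i j
  simp only [Matrix.submatrix_apply, Equiv.ofBijective_apply, hf, Matrix.toSquareBlock_def,
    Matrix.of_apply, h.blockMatrix_apply, runnerBead]
  rw [if_true, if_pos (by omega)]
  congr 2
  omega

lemma Balanced.det_block_of_gt (h : Balanced t n (mr t lam (n * t))) {k : ℕ} (hk' : k < t)
    (hk : t < 2 * k + 1) :
    (h.blockMatrix.toSquareBlock pairClass ⟨k, hk'⟩).det = 1 := by
  -- Classes are represented by the smaller runner of each pair, so the block of an upper runner is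
  -- empty.
  have : IsEmpty {x : BeadIndex t (mr t lam (n * t)) // pairClass x = ⟨k, hk'⟩} :=
    ⟨fun x => by have := (pairClass_eq_iff.1 x.2).1; simp only at this; omega⟩
  exact Matrix.det_isEmpty

lemma Balanced.det_blockMatrix (ht : 2 ≤ t) (h : Balanced t n (mr t lam (n * t))) :
    h.blockMatrix.det =
      (∏ r ∈ Finset.Icc 0 ((t - 2) / 2),
        rs (quot t lam (n * t) r) (quot t lam (n * t) (t - r - 1))) *
      (if Even t then 1 else so (quot t lam (n * t) ((t - 1) / 2))) := by
  set D : ℕ → SymFun := fun k =>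
    if hk : k < t then (h.blockMatrix.toSquareBlock pairClass ⟨k, hk⟩).det else 1 with hD
  have hD' : ∀ k (hk : k < t), D k = (h.blockMatrix.toSquareBlock pairClass ⟨k, hk⟩).det :=
    fun k hk => dif_pos hk
  rw [h.blockTriangular.det_fintype]
  rw [Finset.prod_congr rfl fun (k : Fin t) _ => (hD' k k.isLt).symm, Fin.prod_univ_eq_prod_range D t,
    prod_range_split ht, Finset.prod_eq_one (s := Finset.Icc ((t + 1) / 2) (t - 1)), mul_one]
  · congr 1
    · refine Finset.prod_congr rfl fun r hr => ?_
      rw [Finset.mem_Icc] at hr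
      rw [hD' r (by omega), h.det_block_of_lt (by omega), Nat.sub_right_comm]
    · split_ifs with he
      · rfl
      · rw [Nat.even_iff] at he
        rw [hD' _ (by omega), h.det_block_of_eq (by omega)]
  · intro r hr
    rw [Finset.mem_Icc] at hr
    rw [hD' r (by omega), h.det_block_of_gt (by omega) (by omega)]

end Rows

end UniversalCharacters

open UniversalCharacters
theorem theorem3p4 (t : ℕ) (ht : 2 ≤ t) (n : ℕ) (lam : YoungDiagram)
    (hlen : lam.colLen 0 ≤ n * t) :
    ((core t lam (n * t)).transpose ≠ core t lam (n * t) → phi t (so lam) = 0) ∧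
    ((core t lam (n * t)).transpose = core t lam (n * t) →
      phi t (so lam) =
        (-1) ^ epsSo t n lam *
          (((Equiv.Perm.sign (wPerm t lam (n * t)) : ℤˣ) : ℤ) : SymFun) *
          (∏ r ∈ Finset.Icc 0 ((t - 2) / 2),
            rs (quot t lam (n * t) r) (quot t lam (n * t) (t - r - 1))) *
          (if Even t then 1 else so (quot t lam (n * t) ((t - 1) / 2)))) := by
  have ht0 : 0 < t := by omega
  rw [Ne, transpose_core_eq_iff ht0, phi_so_eq_det hlen]
  refine ⟨fun hne => ?_, fun hbal => ?_⟩
  · by_contra hdet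
    exact hne fun r hr => mr_add_mr_of_det_ne_zero hdet hr
  · have h : Balanced t n (mr t lam (n * t)) := hbal
    have h1 : h.blockMatrix.det = _ :=
      det_submatrix_equiv (phiMatrix t n lam) h.rowEquiv h.colEquiv (lexKey_injective (m := _))
    have h2 := orderSign_mul_self (lexKey (t := t) (m := mr t lam (n * t))) h.rowEquiv h.colEquiv
    -- Relabelling rows and columns by beads costs the sign of rows against columns, which is its
    -- own inverse.
    have h3 : (phiMatrix t n lam).det =
        (orderSign lexKey h.rowEquiv h.colEquiv : ℤ) * h.blockMatrix.det := by
      rw [h1, ← mul_assoc, ← Int.cast_mul, h2, Int.cast_one, one_mul]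
    rw [h3, ← orderSign_mul _ _ lexKey, ← h.sign_wPerm, h.orderSign_lex_col ht,
      ← neg_one_pow_epsSo ht h, h.det_blockMatrix ht]
    push_cast
    ring
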